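/- Let $X$ be a complex Banach space and fix $0<T<\infty$. A bounded analytic semigroup on $X$ is a family $(S(z))_{z\in\Sigma_\theta\cup\{0\}}$ of bounded operators, for some $0<\theta\le\pi/2$ and $\Sigma_\theta=\{z\ne0:|\arg z|<\theta\}$, such that $S(0)=I$, $S(z+w)=S(z)S(w)$, $z\mapsto S(z)$ is holomorphic and uniformly bounded on $\Sigma_\theta$, and $S(z)x\to x$ as $z\to0$ in $\Sigma_\theta$ for every $x\in X$; its generator is $x\mapsto\lim_{t\to0^+}(S(t)x-x)/t$, on the domain where this limit exists. An operator $B$ on $X$ such that $-B$ generates a bounded analytic semigroup satisfies (MR) if the operator $\frac{d}{dt}+B$ on $L^2([0,T);X)$, with domain $\{u\in W^{1,2}([0,T);X):u(0)=0\}\cap L^2([0,T);D(B))$, has a bounded inverse. The space $X$ has (MRP) if every $B$ such that $-B$ generates a bounded analytic semigroup on $X$ satisfies (MR). Let $(E_n)_{n\ge1}$ be a Schauder decomposition of $X$ (closed subspaces such that every $x\in X$ has a unique expansion $x=\sum_{n\ge1}x_n$ with $x_n\in E_n$, the series converging in norm), and let $P_n:x\mapsto x_n$ be the associated (bounded) projections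 of $X$ onto $E_n$. Let $Z_n=P_n^*X^*\subset X^*$, and write $[F,G]$ for the closed linear span of $F\cup G$. Assume that $X$ has (MRP). Then there is a constant $C>0$ such that for every $N$, whenever $u_n\in[E_{2n-1},E_{2n}]$ and $u_n^*\in[Z_{2n-1},Z_{2n}]$ for $1\le n\le N$, $$\left(\int_0^{2\pi}\Big\|\sum_{n=1}^N P_{2n}u_n\,e^{i2^nt}\Big\|^2\frac{dt}{2\pi}\right)^{1/2}\le C\left(\int_0^{2\pi}\Big\|\sum_{n=1}^N u_n\,e^{i2^nt}\Big\|^2\frac{dt}{2\pi}\right)^{1/2}$$ and $$\left(\int_0^{2\pi}\Big\|\sum_{n=1}^N P_{2n}^*u_n^*\,e^{i2^nt}\Big\|^2\frac{dt}{2\pi}\right)^{1/2}\le C\left(\int_0^{2\pi}\Big\|\sum_{n=1}^N u_n^*\,e^{i2^nt}\Big\|^2\frac{dt}{2\pi}\right)^{1/2}.$$ -/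

import Mathlib

open MeasureTheory Set Filter Topology

noncomputable section

/-- The open sector `{z ≠ 0 : |arg z| < θ}`. -/
def openSector (θ : ℝ) : Set ℂ := {z : ℂ | z ≠ 0 ∧ |z.arg| < θ}

/-- `S` is a bounded analytic semigroup on `X`: for some `θ ∈ (0, π/2]` it is holomorphic,
uniformly bounded and multiplicative on the sector of half-angle `θ`, with `S 0 = 1`, and
`S z x → x` as `z → 0` in the sector. Values of `S` outside the sector and `0` play no role. -/
def IsBoundedAnalyticSemigroup {X : Type*} [NormedAddCommGroup X] [NormedSpace ℂ X]
    (S : ℂ → X →L[ℂ] X) : Prop :=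
  ∃ θ : ℝ, 0 < θ ∧ θ ≤ Real.pi / 2 ∧
    S 0 = 1 ∧
    (∀ z ∈ openSector θ, ∀ w ∈ openSector θ, S (z + w) = (S z).comp (S w)) ∧
    DifferentiableOn ℂ S (openSector θ) ∧
    (∃ M : ℝ, ∀ z ∈ openSector θ, ‖S z‖ ≤ M) ∧
    (∀ x : X, Tendsto (fun z => S z x) (𝓝[openSector θ] 0) (𝓝 x))

/-- `G` is the infinitesimal generator of `(S t)_{t ≥ 0}`: `x ∈ D(G)` and `G x = y` exactly when
`(S t x - x) / t → y` as `t → 0+`. -/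
def IsInfinitesimalGenerator {X : Type*} [NormedAddCommGroup X] [NormedSpace ℂ X]
    (G : X →ₗ.[ℂ] X) (S : ℂ → X →L[ℂ] X) : Prop :=
  ∀ x y : X, (x, y) ∈ G.graph ↔
    Tendsto (fun t : ℝ => (t : ℂ)⁻¹ • (S (t : ℂ) x - x)) (𝓝[>] 0) (𝓝 y)

/-- `G` generates a bounded analytic semigroup. -/
def GeneratesBoundedAnalyticSemigroup {X : Type*} [NormedAddCommGroup X] [NormedSpace ℂ X]
    (G : X →ₗ.[ℂ] X) : Prop :=
  ∃ S : ℂ → X →L[ℂ] X, IsBoundedAnalyticSemigroup S ∧ IsInfinitesimalGenerator G S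

/-- The Bochner space `L²([0,T); X)`. -/
abbrev TimeL2 (T : ℝ) (X : Type*) [NormedAddCommGroup X] : Type _ :=
  Lp X 2 (volume.restrict (Ico (0 : ℝ) T))

/-- `u ∈ W₀^{1,2}([0,T); X) = {u ∈ W^{1,2}([0,T); X) : u 0 = 0}` and `u' = v`: here `v` is in
`L²([0,T); X)` and `u` is the primitive of `v` that vanishes at `0`. -/
def HasTimeDeriv {T : ℝ} {X : Type*} [NormedAddCommGroup X] [NormedSpace ℂ X]
    (u v : TimeL2 T X) : Prop :=
  ∀ᵐ t ∂(volume.restrict (Ico (0 : ℝ) T)), u t = ∫ s in (0 : ℝ)..t, v s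

/-- `u ∈ L²([0,T); D(B))` and `w(t) = B (u t)`, the function `w` being in `L²([0,T); X)`. -/
def HasTimeApply {T : ℝ} {X : Type*} [NormedAddCommGroup X] [NormedSpace ℂ X]
    (B : X →ₗ.[ℂ] X) (u w : TimeL2 T X) : Prop :=
  ∀ᵐ t ∂(volume.restrict (Ico (0 : ℝ) T)), (u t, w t) ∈ B.graph

/-- `B` has maximal regularity on `[0,T)`: the operator `d/dt + B` on `L²([0,T); X)`, with domain
`W₀^{1,2}([0,T); X) ∩ L²([0,T); D(B))`, has a bounded inverse `R`. -/
def MaximalRegularity (T : ℝ) {X : Type*} [NormedAddCommGroup X] [NormedSpace ℂ X]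
    (B : X →ₗ.[ℂ] X) : Prop :=
  ∃ R : TimeL2 T X →L[ℂ] TimeL2 T X, ∀ f u : TimeL2 T X,
    R f = u ↔ ∃ v w : TimeL2 T X, HasTimeDeriv u v ∧ HasTimeApply B u w ∧ v + w = f

/-- The maximal regularity property of `X` (on the time interval `[0,T)`): every `B` such that
`-B` generates a bounded analytic semigroup on `X` has maximal regularity. -/
def HasMRP (T : ℝ) (X : Type*) [NormedAddCommGroup X] [NormedSpace ℂ X] : Prop :=
  ∀ B : X →ₗ.[ℂ] X, GeneratesBoundedAnalyticSemigroup (-B) → MaximalRegularity T B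

/-- `(E_n)_{n ≥ 1}` is a Schauder decomposition of `X` with associated projections
`(P_n)_{n ≥ 1}`: the `E_n` are closed subspaces, and every `x` has a unique expansion
`x = ∑ e_n` with `e_n ∈ E_n`, namely the one with `e_n = P_n x`. (In a Banach space the associated
projections are automatically bounded.) The index `0` plays no role. -/
structure IsSchauderDecomposition {X : Type*} [NormedAddCommGroup X] [NormedSpace ℂ X]
    (E : ℕ → Submodule ℂ X) (P : ℕ → X →L[ℂ] X) : Prop where
  isClosed : ∀ n, 1 ≤ n → IsClosed (E n : Set X)
  mem : ∀ n, 1 ≤ n → ∀ x, P n x ∈ E n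
  tendsto : ∀ x, Tendsto (fun N : ℕ => ∑ n ∈ Finset.Icc 1 N, P n x) atTop (𝓝 x)
  unique : ∀ (x : X) (e : ℕ → X), (∀ n, 1 ≤ n → e n ∈ E n) →
    Tendsto (fun N : ℕ => ∑ n ∈ Finset.Icc 1 N, e n) atTop (𝓝 x) → ∀ n, 1 ≤ n → e n = P n x

/-- The Banach space adjoint `P^* : X^* → X^*`, `P^* φ = φ ∘ P`. -/
def dualAdjoint {X : Type*} [NormedAddCommGroup X] [NormedSpace ℂ X] (P : X →L[ℂ] X) :
    StrongDual ℂ X →L[ℂ] StrongDual ℂ X :=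
  P.precomp ℂ

/-- The subspace `P^* X^*` of `X^*`. -/
def dualRange {X : Type*} [NormedAddCommGroup X] [NormedSpace ℂ X] (P : X →L[ℂ] X) :
    Submodule ℂ (StrongDual ℂ X) :=
  LinearMap.range (dualAdjoint P : StrongDual ℂ X →ₗ[ℂ] StrongDual ℂ X)

/-- `[F, G]`: the closed linear span of two subspaces. -/
def closedSpan {Y : Type*} [NormedAddCommGroup Y] [NormedSpace ℂ Y] (F G : Submodule ℂ Y) :
    Submodule ℂ Y :=
  (Submodule.span ℂ ((F : Set Y) ∪ (G : Set Y))).topologicalClosure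

/-- The norm `(∫_0^{2π} ‖∑_{n=1}^N y_n e^{i 2^n t}‖² dt/2π)^{1/2}`. -/
def lacunaryNorm {Y : Type*} [NormedAddCommGroup Y] [NormedSpace ℂ Y] (N : ℕ) (y : ℕ → Y) : ℝ :=
  Real.sqrt (∫ t in (0 : ℝ)..(2 * Real.pi),
    ‖∑ n ∈ Finset.Icc 1 N, Complex.exp (Complex.I * 2 ^ n * t) • y n‖ ^ 2 / (2 * Real.pi))

end

/-! Maximal regularity is applied to a single operator `B` that acts as multiplication by `2^(n-1)`
on the range of `P (2n-1)` and by `2^n` on the range of `P (2n)`. The eigenvalues increase to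
infinity, so Abel summation against the uniformly bounded partial sums of the projections shows that
`-B` generates a bounded analytic semigroup (`exists_diagonal_operator`). The closed graph theorem
then turns maximal regularity into an `L²` bound for `B (d/dt + B)⁻¹`
(`MaximalRegularity.exists_norm_le`).

For a right-hand side of period `T/2`, the solution starting at `0` differs from the periodic
solution by an orbit of the semigroup. On the second period that orbit is controlled by the value of
the solution after one period. Hence the Fourier multiplier `j ↦ B (B + i j)⁻¹` is bounded on
vector-valued `L²` of the circle, uniformly over truncations
(`HasMRP.exists_circleNorm_dyadicMultiplier_le`).

At frequency `2^n` this multiplier acts on the `n`-th block by the scalar `1/(1+2i)` on the odd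
component and `1/(1+i)` on the even one. Neither scalar depends on `n` and they differ, so the even
component is a fixed linear combination of the multiplier and the identity; this gives the first
inequality. The second follows by duality: a lacunary polynomial with values in the dual is paired
with arbitrary trigonometric polynomials, the pairing sees only their frequencies `-2^n`, and there
the adjoint multiplier acts by the conjugate scalars
(`IsSchauderDecomposition.integral_trigPolynomial_apply_eq`,
`circleNorm_le_of_forall_trigPolynomial`). -/

/-! ### Coordinate projections and Abel summation -/

/-- Pairwise annihilating projections `p 0, p 1, …` whose partial sums converge strongly to the
identity. -/
structure IsCoordinateProjections {X : Type*} [NormedAddCommGroup X] [NormedSpace ℂ X]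
    (p : ℕ → X →L[ℂ] X) : Prop where
  apply_self : ∀ k x, p k (p k x) = p k x
  apply_of_ne : ∀ k l x, k ≠ l → p k (p l x) = 0
  tendsto : ∀ x, Tendsto (fun n : ℕ => ∑ k ∈ Finset.range n, p k x) atTop (𝓝 x)

namespace IsSchauderDecomposition

variable {X : Type*} [NormedAddCommGroup X] [NormedSpace ℂ X]
  {E : ℕ → Submodule ℂ X} {P : ℕ → X →L[ℂ] X}

theorem apply_of_mem (h : IsSchauderDecomposition E P) {n : ℕ} (hn : 1 ≤ n) {x : X}
    (hx : x ∈ E n) {k : ℕ} (hk : 1 ≤ k) : P k x = if k = n then x else 0 := by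
  refine (h.unique x (fun k => if k = n then x else 0) (fun m _ => ?_) ?_ k hk).symm
  · split_ifs with hm
    · exact hm ▸ hx
    · exact zero_mem _
  · refine tendsto_const_nhds.congr' ?_
    filter_upwards [eventually_ge_atTop n] with N hN
    rw [Finset.sum_ite_eq', if_pos (Finset.mem_Icc.2 ⟨hn, hN⟩)]

theorem isCoordinateProjections (h : IsSchauderDecomposition E P) :
    IsCoordinateProjections fun k => P (k + 1) where
  apply_self k x := by
    rw [h.apply_of_mem (Nat.le_add_left 1 k) (h.mem _ (Nat.le_add_left 1 k) x)
      (Nat.le_add_left 1 k), if_pos rfl]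
  apply_of_ne k l x hkl := by
    rw [h.apply_of_mem (Nat.le_add_left 1 l) (h.mem _ (Nat.le_add_left 1 l) x)
      (Nat.le_add_left 1 k), if_neg (by omega)]
  tendsto x := by
    refine (h.tendsto x).congr fun n => ?_
    rw [Finset.range_eq_Ico, Finset.sum_Ico_add' (fun k => P k x) 0 n 1]
    rfl

end IsSchauderDecomposition

theorem sum_range_sub_smul_sum_range {X : Type*} [AddCommGroup X] [Module ℂ X]
    (c : ℕ → ℂ) (y : ℕ → X) (n : ℕ) :
    ∑ l ∈ Finset.range n, (c l - c (l + 1)) • ∑ k ∈ Finset.range (l + 1), y k =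
      ∑ l ∈ Finset.range n, c l • y l - c n • ∑ k ∈ Finset.range n, y k := by
  induction n with
  | zero => simp
  | succ n ih =>
    rw [Finset.sum_range_succ, ih, Finset.sum_range_succ (fun l => c l • y l),
      Finset.sum_range_succ y n]
    simp only [sub_smul, smul_add]
    abel

/-- After Abel summation the weights `c l - c (l + 1)` and `c n` are nonnegative and add up to `c
0`. -/
theorem norm_sum_range_smul_le_of_antitone {X : Type*} [NormedAddCommGroup X] [NormedSpace ℂ X]
    {c : ℕ → ℝ} (hc : Antitone c) (hc0 : ∀ k, 0 ≤ c k) {y : ℕ → X} {M : ℝ}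
    (hy : ∀ n, ‖∑ k ∈ Finset.range n, y k‖ ≤ M) (n : ℕ) :
    ‖∑ k ∈ Finset.range n, (c k : ℂ) • y k‖ ≤ c 0 * M := by
  have h := sum_range_sub_smul_sum_range (fun k => (c k : ℂ)) y n
  rw [eq_sub_iff_add_eq] at h
  rw [← h]
  calc _ ≤ ∑ l ∈ Finset.range n, (c l - c (l + 1)) * M + c n * M := by
        refine (norm_add_le _ _).trans (add_le_add ((norm_sum_le _ _).trans
          (Finset.sum_le_sum fun l _ => ?_)) ?_)
        · rw [norm_smul, ← Complex.ofReal_sub, Complex.norm_real, Real.norm_eq_abs,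
            abs_of_nonneg (sub_nonneg.2 (hc (Nat.le_succ l)))]
          exact mul_le_mul_of_nonneg_left (hy _) (sub_nonneg.2 (hc (Nat.le_succ l)))
        · rw [norm_smul, Complex.norm_real, Real.norm_eq_abs, abs_of_nonneg (hc0 n)]
          exact mul_le_mul_of_nonneg_left (hy _) (hc0 n)
    _ = c 0 * M := by
        rw [← Finset.sum_mul, Finset.sum_range_sub']
        ring

namespace IsCoordinateProjections

variable {X : Type*} [NormedAddCommGroup X] [NormedSpace ℂ X] {p : ℕ → X →L[ℂ] X}

theorem eq_of_forall_apply_eq (h : IsCoordinateProjections p) {x y : X}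
    (hxy : ∀ k, p k x = p k y) : x = y := by
  refine tendsto_nhds_unique (h.tendsto x) ((h.tendsto y).congr fun n => ?_)
  exact Finset.sum_congr rfl fun k _ => (hxy k).symm

theorem apply_sum (h : IsCoordinateProjections p) (x : ℕ → X) (k n : ℕ) :
    p k (∑ l ∈ Finset.range n, p l (x l)) = if k < n then p k (x k) else 0 := by
  rw [map_sum]
  by_cases hk : k < n
  · rw [if_pos hk, Finset.sum_eq_single k (fun l _ hl => h.apply_of_ne k l _ hl.symm)
      (fun hn => absurd (Finset.mem_range.2 hk) hn), h.apply_self]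
  · rw [if_neg hk]
    refine Finset.sum_eq_zero fun l hl => h.apply_of_ne k l _ ?_
    rintro rfl
    exact hk (Finset.mem_range.1 hl)

theorem exists_norm_sum_le [CompleteSpace X] (h : IsCoordinateProjections p) :
    ∃ K : ℝ, 0 < K ∧ ∀ n, ‖∑ k ∈ Finset.range n, p k‖ ≤ K := by
  obtain ⟨K, hK⟩ := banach_steinhaus (g := fun n => ∑ k ∈ Finset.range n, p k) fun x => by
    obtain ⟨C, hC⟩ := (h.tendsto x).norm.bddAbove_range
    refine ⟨C, fun n => ?_⟩
    simpa [sum_apply] using hC ⟨n, rfl⟩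
  exact ⟨max K 1, by positivity, fun n => (hK n).trans (le_max_left _ _)⟩

end IsCoordinateProjections

/-! ### The diagonal semigroup and its generator -/

/-- The difference is the integral of `z e^{-sz}` over `[a, b]`, dominated by that of `‖z‖ e^{-sr}`.
The resulting bound telescopes along an increasing sequence, and for `r = z.re` its prefactor is
bounded on a sector. -/
theorem norm_exp_sub_exp_le {z : ℂ} {r : ℝ} (hr : 0 < r) (hz : r ≤ z.re) {a b : ℝ} (ha : 0 ≤ a)
    (hab : a ≤ b) :
    ‖Complex.exp (-(a * z)) - Complex.exp (-(b * z))‖ ≤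
      ‖z‖ / r * (Real.exp (-(a * r)) - Real.exp (-(b * r))) := by
  have h1 : ∫ s in a..b, z * Complex.exp (-(s * z)) =
      Complex.exp (-(a * z)) - Complex.exp (-(b * z)) := by
    rw [intervalIntegral.integral_eq_sub_of_hasDerivAt
      (f := fun s : ℝ => -Complex.exp (-(s * z)))]
    · ring
    · intro s _
      have := ((((hasDerivAt_id s).ofReal_comp).mul_const z).neg.cexp).neg
      convert! this using 1
      simp
      ring
    · exact (by fun_prop : Continuous fun s : ℝ => z * Complex.exp (-(s * z))).intervalIntegrable _ _
  have hc : Continuous fun s : ℝ => ‖z‖ * Real.exp (-(s * r)) := by fun_prop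
  have h2 : ∫ s in a..b, ‖z‖ * Real.exp (-(s * r)) =
      ‖z‖ / r * (Real.exp (-(a * r)) - Real.exp (-(b * r))) := by
    rw [intervalIntegral.integral_eq_sub_of_hasDerivAt
      (f := fun s : ℝ => -(‖z‖ / r) * Real.exp (-(s * r)))]
    · ring
    · intro s _
      have := (((((hasDerivAt_id s)).mul_const r).neg.exp).const_mul (-(‖z‖ / r)))
      convert! this using 1
      simp
      field_simp
    · exact hc.intervalIntegrable _ _
  rw [← h1, ← h2]
  refine intervalIntegral.norm_integral_le_of_norm_le hab (Eventually.of_forall fun s hs => ?_)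
    (hc.intervalIntegrable _ _)
  have hs0 : 0 ≤ s := ha.trans hs.1.le
  rw [norm_mul, Complex.norm_exp]
  refine mul_le_mul_of_nonneg_left (Real.exp_le_exp.2 ?_) (norm_nonneg z)
  simpa using mul_le_mul_of_nonneg_left hz hs0

theorem re_pos_and_norm_le_of_mem_openSector {z : ℂ} (hz : z ∈ openSector (Real.pi / 4)) :
    0 < z.re ∧ ‖z‖ ≤ 2 * z.re := by
  obtain ⟨h0, harg⟩ := hz
  have hn : 0 < ‖z‖ := norm_pos_iff.2 h0
  -- Comparing with the wider angle `π/3`, whose cosine is `1/2`, gives the convenient constant `2`.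
  have h1 : Real.cos (Real.pi / 3) ≤ Real.cos |z.arg| :=
    Real.cos_le_cos_of_nonneg_of_le_pi (abs_nonneg _) (by linarith [Real.pi_pos])
      (by linarith [Real.pi_pos])
  rw [Real.cos_abs, Complex.cos_arg h0, Real.cos_pi_div_three, le_div_iff₀ hn] at h1
  constructor <;> linarith

theorem hasSum_sub_succ_of_tendsto_zero {a : ℕ → ℝ} (ha : Antitone a)
    (h0 : Tendsto a atTop (𝓝 0)) : HasSum (fun k => a k - a (k + 1)) (a 0) := by
  rw [hasSum_iff_tendsto_nat_of_nonneg fun k => sub_nonneg.2 (ha (Nat.le_succ k))]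
  simp only [Finset.sum_range_sub']
  simpa using tendsto_const_nhds.sub h0

section Multiplier

variable {X : Type*} [NormedAddCommGroup X] [NormedSpace ℂ X]

/-- The graph of the infinitesimal generator. -/
def generatorGraph (S : ℂ → X →L[ℂ] X) : Submodule ℂ (X × X) where
  carrier := {q | Tendsto (fun t : ℝ => (t : ℂ)⁻¹ • (S (t : ℂ) q.1 - q.1)) (𝓝[>] 0) (𝓝 q.2)}
  add_mem' {q r} hq hr := by
    refine (Tendsto.add hq hr).congr fun t => ?_
    rw [← smul_add, Prod.fst_add, map_add]
    congr 1
    abel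
  zero_mem' := by simp
  smul_mem' c q hq := by
    refine (Tendsto.const_smul hq c).congr fun t => ?_
    rw [Prod.smul_fst, map_smul, ← smul_sub, smul_comm]

theorem exists_isInfinitesimalGenerator (S : ℂ → X →L[ℂ] X) :
    ∃ G : X →ₗ.[ℂ] X, IsInfinitesimalGenerator G S := by
  refine ⟨(generatorGraph S).toLinearPMap, fun x y => ?_⟩
  rw [Submodule.toLinearPMap_graph_eq]
  · rfl
  · rintro ⟨q, r⟩ hq (rfl : q = 0)
    refine tendsto_nhds_unique hq ?_
    simp

theorem LinearPMap.mem_graph_neg_iff (B : X →ₗ.[ℂ] X) (x y : X) :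
    (x, y) ∈ (-B).graph ↔ (x, -y) ∈ B.graph := by
  simp only [LinearPMap.mem_graph_iff, LinearPMap.neg_domain, LinearPMap.neg_apply,
    neg_eq_iff_eq_neg]

/-- The semigroup `z ↦ ∑ exp (-b_k z) p_k`, written as an absolutely convergent series in the
partial sums of the projections `p_k`. -/
noncomputable def multiplierSemigroup (p : ℕ → X →L[ℂ] X) (b : ℕ → ℝ) (z : ℂ) : X →L[ℂ] X :=
  open Classical in
  if z = 0 then 1 else
    ∑' k, (Complex.exp (-(b k * z)) - Complex.exp (-(b (k + 1) * z))) •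
      ∑ l ∈ Finset.range (k + 1), p l

variable {p : ℕ → X →L[ℂ] X} {b : ℕ → ℝ} {K : ℝ}

theorem hasSum_exp_sub_exp (hb : Monotone b) (hb' : Tendsto b atTop atTop) {r : ℝ} (hr : 0 < r) :
    HasSum (fun k => Real.exp (-(b k * r)) - Real.exp (-(b (k + 1) * r)))
      (Real.exp (-(b 0 * r))) := by
  refine hasSum_sub_succ_of_tendsto_zero (a := fun k => Real.exp (-(b k * r))) ?_ ?_
  · intro k l hkl
    exact Real.exp_le_exp.2 (neg_le_neg (mul_le_mul_of_nonneg_right (hb hkl) hr.le))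
  · exact Real.tendsto_exp_neg_atTop_nhds_zero.comp (hb'.atTop_mul_const hr)

theorem norm_multiplierSemigroup_term_le (hK : ∀ n, ‖∑ k ∈ Finset.range n, p k‖ ≤ K)
    (hb : Monotone b) (hb0 : ∀ k, 0 < b k) {z : ℂ} {r : ℝ}
    (hr : 0 < r) (hz : r ≤ z.re) (k : ℕ) :
    ‖(Complex.exp (-(b k * z)) - Complex.exp (-(b (k + 1) * z))) •
      ∑ l ∈ Finset.range (k + 1), p l‖ ≤
      ‖z‖ / r * (Real.exp (-(b k * r)) - Real.exp (-(b (k + 1) * r))) * K := by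
  have h := norm_exp_sub_exp_le hr hz (hb0 k).le (hb (Nat.le_succ k))
  rw [norm_smul]
  exact mul_le_mul h (hK _) (norm_nonneg _) ((norm_nonneg _).trans h)

theorem norm_multiplierSemigroup_le (hK : ∀ n, ‖∑ k ∈ Finset.range n, p k‖ ≤ K)
    (hb : Monotone b) (hb0 : ∀ k, 0 < b k) (hb' : Tendsto b atTop atTop) {z : ℂ}
    (hz : 0 < z.re) : ‖multiplierSemigroup p b z‖ ≤ ‖z‖ / z.re * K := by
  have hz0 : z ≠ 0 := by rintro rfl; simp at hz
  have hK0 : 0 ≤ K := (norm_nonneg _).trans (hK 0)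
  rw [multiplierSemigroup, if_neg hz0]
  refine (tsum_of_norm_bounded (((hasSum_exp_sub_exp hb hb' hz).mul_left _).mul_right K)
    (norm_multiplierSemigroup_term_le hK hb hb0 hz le_rfl)).trans ?_
  refine mul_le_mul_of_nonneg_right (mul_le_of_le_one_right (by positivity) ?_) hK0
  exact Real.exp_le_one_iff.2 (neg_nonpos.2 (mul_pos (hb0 0) hz).le)

variable [CompleteSpace X]

/-- Abel summation undone: the boundary term vanishes because `e^{-b_n z}` tends to `0` while the
partial sums of the projections converge. -/
theorem tendsto_multiplierSemigroup (hp : IsCoordinateProjections p)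
    (hK : ∀ n, ‖∑ k ∈ Finset.range n, p k‖ ≤ K)
    (hb : Monotone b) (hb0 : ∀ k, 0 < b k) (hb' : Tendsto b atTop atTop) {z : ℂ} (hz : 0 < z.re) (x : X) :
    Tendsto (fun n => ∑ k ∈ Finset.range n, Complex.exp (-(b k * z)) • p k x) atTop
      (𝓝 (multiplierSemigroup p b z x)) := by
  have hz0 : z ≠ 0 := by rintro rfl; simp at hz
  have hs := (Summable.of_norm_bounded
    (((hasSum_exp_sub_exp hb hb' hz).mul_left (‖z‖ / z.re)).mul_right K).summable
    (norm_multiplierSemigroup_term_le hK hb hb0 hz le_rfl)).hasSum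
  have h1 := (hs.mapL (ContinuousLinearMap.apply ℂ X x)).tendsto_sum_nat
  have h2 : Tendsto (fun n => Complex.exp (-(b n * z)) • ∑ k ∈ Finset.range n, p k x) atTop
      (𝓝 0) := by
    have h3 : Tendsto (fun n => Complex.exp (-(b n * z))) atTop (𝓝 0) := by
      rw [tendsto_zero_iff_norm_tendsto_zero]
      simp only [Complex.norm_exp]
      refine (Real.tendsto_exp_neg_atTop_nhds_zero.comp (hb'.atTop_mul_const hz)).congr fun n => ?_
      simp
    simpa using h3.smul (hp.tendsto x)
  have h4 := h1.add h2
  rw [add_zero] at h4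
  rw [multiplierSemigroup, if_neg hz0]
  refine h4.congr fun n => ?_
  rw [← eq_sub_iff_add_eq]
  rw [← sum_range_sub_smul_sum_range (fun k => Complex.exp (-(b k * z)))]
  simp

theorem apply_multiplierSemigroup (hp : IsCoordinateProjections p)
    (hK : ∀ n, ‖∑ k ∈ Finset.range n, p k‖ ≤ K)
    (hb : Monotone b) (hb0 : ∀ k, 0 < b k) (hb' : Tendsto b atTop atTop) {z : ℂ} (hz : 0 < z.re) (k : ℕ) (x : X) :
    p k (multiplierSemigroup p b z x) = Complex.exp (-(b k * z)) • p k x := by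
  refine tendsto_nhds_unique (((p k).continuous.tendsto _).comp
    (tendsto_multiplierSemigroup hp hK hb hb0 hb' hz x)) (tendsto_const_nhds.congr' ?_)
  filter_upwards [eventually_gt_atTop k] with n hn
  have := hp.apply_sum (fun l => Complex.exp (-(b l * z)) • x) k n
  simp only [map_smul, if_pos hn] at this
  exact this.symm

theorem multiplierSemigroup_apply (hp : IsCoordinateProjections p)
    (hK : ∀ n, ‖∑ k ∈ Finset.range n, p k‖ ≤ K)
    (hb : Monotone b) (hb0 : ∀ k, 0 < b k) (hb' : Tendsto b atTop atTop) {z : ℂ} (hz : 0 < z.re) (k : ℕ) (x : X) :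
    multiplierSemigroup p b z (p k x) = Complex.exp (-(b k * z)) • p k x := by
  refine hp.eq_of_forall_apply_eq fun l => ?_
  rw [apply_multiplierSemigroup hp hK hb hb0 hb' hz, map_smul]
  rcases eq_or_ne l k with rfl | hlk
  · rfl
  · rw [hp.apply_of_ne l k x hlk, smul_zero, smul_zero]

theorem differentiableOn_multiplierSemigroup (hK : ∀ n, ‖∑ k ∈ Finset.range n, p k‖ ≤ K)
    (hb : Monotone b) (hb0 : ∀ k, 0 < b k) (hb' : Tendsto b atTop atTop) :
    DifferentiableOn ℂ (multiplierSemigroup p b) {z | 0 < z.re} := by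
  intro z hz
  have hz : 0 < z.re := hz
  -- On this neighbourhood the real part is bounded below and the norm above, so one summable
  -- majorant serves every point.
  set U : Set ℂ := {w | z.re / 2 < w.re} ∩ Metric.ball 0 (‖z‖ + 1) with hU
  have hUo : IsOpen U := (isOpen_lt continuous_const Complex.continuous_re).inter Metric.isOpen_ball
  have hzU : z ∈ U := ⟨by simp only [mem_ofPred_eq]; linarith, by simp⟩
  have hK0 : 0 ≤ K := (norm_nonneg _).trans (hK 0)
  have hd : DifferentiableOn ℂ (fun w => ∑' k, (Complex.exp (-(b k * w)) -
      Complex.exp (-(b (k + 1) * w))) • ∑ l ∈ Finset.range (k + 1), p l) U := by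
    refine Complex.differentiableOn_tsum_of_summable_norm
      (u := fun k => (‖z‖ + 1) / (z.re / 2) * (Real.exp (-(b k * (z.re / 2))) -
        Real.exp (-(b (k + 1) * (z.re / 2)))) * K)
      (((hasSum_exp_sub_exp hb hb' (half_pos hz)).mul_left _).mul_right K).summable
      (fun k => ?_) hUo fun k w hw => ?_
    · exact Differentiable.differentiableOn (by fun_prop)
    · refine (norm_multiplierSemigroup_term_le hK hb hb0 (half_pos hz) hw.1.le k).trans ?_
      have hw2 : ‖w‖ ≤ ‖z‖ + 1 := (mem_ball_zero_iff.1 hw.2).le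
      have hm : 0 ≤ Real.exp (-(b k * (z.re / 2))) - Real.exp (-(b (k + 1) * (z.re / 2))) :=
        sub_nonneg.2 (Real.exp_le_exp.2 (neg_le_neg
          (mul_le_mul_of_nonneg_right (hb (Nat.le_succ k)) (half_pos hz).le)))
      gcongr
  have hd' : DifferentiableOn ℂ (multiplierSemigroup p b) U := by
    refine hd.congr fun w hw => ?_
    have hw0 : w ≠ 0 := by
      rintro rfl
      have : z.re / 2 < (0 : ℂ).re := hw.1
      simp at this
      linarith
    rw [multiplierSemigroup, if_neg hw0]
  exact (hd'.differentiableAt (hUo.mem_nhds hzU)).differentiableWithinAt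

theorem isBoundedAnalyticSemigroup_multiplierSemigroup (hp : IsCoordinateProjections p)
    (hb : Monotone b) (hb0 : ∀ k, 0 < b k) (hb' : Tendsto b atTop atTop) :
    IsBoundedAnalyticSemigroup (multiplierSemigroup p b) := by
  obtain ⟨K, hK0, hK⟩ := hp.exists_norm_sum_le
  have hM : ∀ z ∈ openSector (Real.pi / 4), ‖multiplierSemigroup p b z‖ ≤ 2 * K := by
    intro z hz
    obtain ⟨h1, h2⟩ := re_pos_and_norm_le_of_mem_openSector hz
    refine (norm_multiplierSemigroup_le hK hb hb0 hb' h1).trans ?_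
    have : ‖z‖ / z.re ≤ 2 := (div_le_iff₀ h1).2 h2
    gcongr
  refine ⟨Real.pi / 4, by positivity, by linarith [Real.pi_pos], if_pos rfl, ?_, ?_, ⟨_, hM⟩, ?_⟩
  · intro z hz w hw
    have hz' := (re_pos_and_norm_le_of_mem_openSector hz).1
    have hw' := (re_pos_and_norm_le_of_mem_openSector hw).1
    have hzw : 0 < (z + w).re := by simpa using add_pos hz' hw'
    ext x
    refine hp.eq_of_forall_apply_eq fun k => ?_
    rw [ContinuousLinearMap.comp_apply, apply_multiplierSemigroup hp hK hb hb0 hb' hzw,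
      apply_multiplierSemigroup hp hK hb hb0 hb' hz', apply_multiplierSemigroup hp hK hb hb0 hb' hw',
      smul_smul, ← Complex.exp_add]
    ring_nf
  · exact (differentiableOn_multiplierSemigroup hK hb hb0 hb').mono fun z hz =>
      (re_pos_and_norm_le_of_mem_openSector hz).1
  · intro x
    rw [Metric.tendsto_nhds]
    intro ε hε
    -- Strong continuity is clear on finite sums of eigenvectors, so `x` is approximated by a
    -- partial sum `y`. In the tolerance, `2 * K` pays for the semigroup applied to `x - y` and `1`
    -- for `x - y` itself.
    have h1 : ∀ᶠ n in atTop, ‖x - ∑ k ∈ Finset.range n, p k x‖ < ε / 2 / (2 * K + 1) := by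
      have := (tendsto_const_nhds (x := x)).sub (hp.tendsto x)
      rw [sub_self] at this
      have := this.norm
      rw [norm_zero] at this
      exact this.eventually_lt_const (by positivity)
    obtain ⟨n, hn⟩ := h1.exists
    rw [lt_div_iff₀ (by positivity)] at hn
    set y := ∑ k ∈ Finset.range n, p k x with hy
    have h2 : Tendsto (fun z : ℂ => ∑ k ∈ Finset.range n, Complex.exp (-(b k * z)) • p k x)
        (𝓝[openSector (Real.pi / 4)] 0) (𝓝 y) := by
      have hc : Continuous fun z : ℂ => ∑ k ∈ Finset.range n, Complex.exp (-(b k * z)) • p k x := by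
        fun_prop
      have := (hc.tendsto 0).mono_left (nhdsWithin_le_nhds (s := openSector (Real.pi / 4)))
      simpa using this
    filter_upwards [(Metric.tendsto_nhds.1 h2) (ε / 2) (half_pos hε), self_mem_nhdsWithin]
      with z hz hzs
    have hz' := (re_pos_and_norm_le_of_mem_openSector hzs).1
    have h3 : multiplierSemigroup p b z y =
        ∑ k ∈ Finset.range n, Complex.exp (-(b k * z)) • p k x := by
      rw [hy, map_sum]
      exact Finset.sum_congr rfl fun k _ => multiplierSemigroup_apply hp hK hb hb0 hb' hz' k x
    rw [← h3, dist_eq_norm] at hz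
    rw [dist_eq_norm]
    have h4 : multiplierSemigroup p b z x - x =
        multiplierSemigroup p b z (x - y) + (multiplierSemigroup p b z y - y) - (x - y) := by
      rw [map_sub]; abel
    have h5 := ((multiplierSemigroup p b z).le_opNorm (x - y)).trans
      (mul_le_mul_of_nonneg_right (hM z hzs) (norm_nonneg _))
    have h6 := norm_sub_le (multiplierSemigroup p b z (x - y) + (multiplierSemigroup p b z y - y))
      (x - y)
    have h7 := norm_add_le (multiplierSemigroup p b z (x - y)) (multiplierSemigroup p b z y - y)
    rw [h4]
    linarith

/-- A sectorial operator acting on the range of each `p k` as multiplication by `b k`. -/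
theorem exists_diagonal_operator (hp : IsCoordinateProjections p)
    (hb : Monotone b) (hb0 : ∀ k, 0 < b k) (hb' : Tendsto b atTop atTop) :
    ∃ B : X →ₗ.[ℂ] X, GeneratesBoundedAnalyticSemigroup (-B) ∧
      (∀ x y, (x, y) ∈ B.graph → ∀ k, p k y = (b k : ℂ) • p k x) ∧
      ∀ k x, (p k x, (b k : ℂ) • p k x) ∈ B.graph := by
  obtain ⟨K, hK0, hK⟩ := hp.exists_norm_sum_le
  obtain ⟨G, hG⟩ := exists_isInfinitesimalGenerator (multiplierSemigroup p b)
  have key : ∀ (k : ℕ) (x : X), Tendsto (fun t : ℝ => (t : ℂ)⁻¹ •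
      (Complex.exp (-(b k * t)) • p k x - p k x)) (𝓝[>] 0) (𝓝 (-((b k : ℂ) • p k x))) := by
    intro k x
    have h := ((((hasDerivAt_id (0 : ℝ)).ofReal_comp).const_mul (b k : ℂ)).neg.cexp).smul_const
      (p k x)
    have h' := h.tendsto_slope_zero_right
    simp at h'
    rw [Complex.coe_smul]
    refine h'.congr fun t => ?_
    rw [← Complex.coe_smul, Complex.ofReal_inv]
  refine ⟨-G, ⟨_, isBoundedAnalyticSemigroup_multiplierSemigroup hp hb hb0 hb', by rwa [neg_neg]⟩,
    fun x y hxy k => ?_, fun k x => ?_⟩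
  · rw [LinearPMap.mem_graph_neg_iff, hG] at hxy
    have h1 := ((p k).continuous.tendsto _).comp hxy
    have h2 := tendsto_nhds_unique (h1.congr' ?_) (key k x)
    · rw [map_neg, neg_inj] at h2
      exact h2
    · filter_upwards [self_mem_nhdsWithin] with t ht
      have ht' : 0 < ((t : ℂ)).re := by simpa using ht
      simp only [Function.comp_apply, map_smul, map_sub]
      rw [apply_multiplierSemigroup hp hK hb hb0 hb' ht']
  · rw [LinearPMap.mem_graph_neg_iff, hG]
    refine (key k x).congr' ?_
    filter_upwards [self_mem_nhdsWithin] with t ht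
    have ht' : 0 < ((t : ℂ)).re := by simpa using ht
    rw [multiplierSemigroup_apply hp hK hb hb0 hb' ht']

end Multiplier

/-! ### Boundedness of `B (d/dt + B)⁻¹` -/

section Bound

variable {X : Type*} [NormedAddCommGroup X] [NormedSpace ℂ X] {p : ℕ → X →L[ℂ] X} {b : ℕ → ℝ}

theorem IsCoordinateProjections.lp_eq_of_forall_compLpL_eq (hp : IsCoordinateProjections p)
    {T : ℝ} {w w' : TimeL2 T X}
    (h : ∀ k, (p k).compLpL 2 (volume.restrict (Ico (0 : ℝ) T)) w =
      (p k).compLpL 2 (volume.restrict (Ico (0 : ℝ) T)) w') : w = w' := by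
  refine Lp.ext ?_
  have h1 : ∀ k, ∀ᵐ t ∂(volume.restrict (Ico (0 : ℝ) T)), p k (w t) = p k (w' t) := by
    intro k
    have h2 := (p k).coeFn_compLpL (p := 2) w
    have h3 := (p k).coeFn_compLpL (p := 2) w'
    rw [← h k] at h3
    filter_upwards [h2, h3] with t h4 h5
    rw [← h4, ← h5]
  filter_upwards [ae_all_iff.2 h1] with t ht
  exact hp.eq_of_forall_apply_eq ht

theorem HasTimeApply.compLpL_eq {B : X →ₗ.[ℂ] X}
    (hB : ∀ x y, (x, y) ∈ B.graph → ∀ k, p k y = (b k : ℂ) • p k x) {T : ℝ} {u w : TimeL2 T X}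
    (h : HasTimeApply B u w) (k : ℕ) :
    (p k).compLpL 2 (volume.restrict (Ico (0 : ℝ) T)) w =
      (b k : ℂ) • (p k).compLpL 2 (volume.restrict (Ico (0 : ℝ) T)) u := by
  refine Lp.ext ?_
  filter_upwards [(p k).coeFn_compLpL (p := 2) w, (p k).coeFn_compLpL (p := 2) u, h,
    Lp.coeFn_smul (b k : ℂ) ((p k).compLpL 2 (volume.restrict (Ico (0 : ℝ) T)) u)]
    with t h1 h2 h3 h4
  rw [h1, h4, Pi.smul_apply, h2]
  exact hB _ _ h3 k

variable [CompleteSpace X]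

/-- The map `f ↦ B (R f)` is defined on all of `L²`, and its `k`-th coordinate `b k • p k (R f)` is
continuous in `f`. Coordinates separate points, so the map is linear with closed graph, hence
bounded. -/
theorem MaximalRegularity.exists_norm_le (hp : IsCoordinateProjections p) {B : X →ₗ.[ℂ] X}
    (hB : ∀ x y, (x, y) ∈ B.graph → ∀ k, p k y = (b k : ℂ) • p k x) {T : ℝ}
    (h : MaximalRegularity T B) :
    ∃ C : ℝ, 0 ≤ C ∧ ∀ u v w : TimeL2 T X, HasTimeDeriv u v → HasTimeApply B u w →
      ‖w‖ ≤ C * ‖v + w‖ := by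
  obtain ⟨R, hR⟩ := h
  let L : ℕ → TimeL2 T X →L[ℂ] TimeL2 T X :=
    fun k => (p k).compLpL 2 (volume.restrict (Ico (0 : ℝ) T))
  have hex : ∀ f : TimeL2 T X, ∃ w : TimeL2 T X, ∀ k, L k w = (b k : ℂ) • L k (R f) := by
    intro f
    obtain ⟨v, w, _, hw, _⟩ := (hR f (R f)).1 rfl
    exact ⟨w, hw.compLpL_eq hB⟩
  choose A hA using hex
  let A' : TimeL2 T X →ₗ[ℂ] TimeL2 T X :=
    { toFun := A
      map_add' := fun f g => hp.lp_eq_of_forall_compLpL_eq fun k => by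
        change L k _ = L k _
        rw [map_add (L k), hA, hA, hA, map_add R, map_add (L k), smul_add]
      map_smul' := fun c f => hp.lp_eq_of_forall_compLpL_eq fun k => by
        change L k _ = L k _
        rw [RingHom.id_apply, map_smul (L k), hA, hA, map_smul R, map_smul (L k), smul_comm] }
  have hcont : Continuous A' := by
    refine A'.continuous_of_seq_closed_graph fun f g w hf hw => ?_
    refine hp.lp_eq_of_forall_compLpL_eq fun k => ?_
    change L k w = L k (A g)
    rw [hA]
    refine tendsto_nhds_unique (((L k).continuous.tendsto _).comp hw)
      (Tendsto.congr (fun n => (hA (f n) k).symm) ?_)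
    exact ((((L k).continuous.comp R.continuous).tendsto g).comp hf).const_smul (b k : ℂ)
  let A'' : TimeL2 T X →L[ℂ] TimeL2 T X := ⟨A', hcont⟩
  refine ⟨‖A''‖, norm_nonneg _, fun u v w hv hw => ?_⟩
  have hu : R (v + w) = u := (hR _ _).2 ⟨v, w, hv, hw, rfl⟩
  have hwA : w = A'' (v + w) := hp.lp_eq_of_forall_compLpL_eq fun k => by
    change L k w = L k (A (v + w))
    rw [hA, hu]
    exact hw.compLpL_eq hB k
  conv_lhs => rw [hwA]
  exact A''.le_opNorm _

end Bound

/-! ### From the initial value problem to periodic multipliers -/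

theorem norm_toLp_two_sq {α F : Type*} [MeasurableSpace α] {μ : Measure α} [NormedAddCommGroup F]
    {f : α → F} (hf : MemLp f 2 μ) : ‖hf.toLp f‖ ^ 2 = ∫ a, ‖f a‖ ^ 2 ∂μ := by
  rw [Lp.norm_toLp, hf.eLpNorm_eq_integral_rpow_norm (by norm_num) (by norm_num)]
  have h0 : 0 ≤ ∫ a, ‖f a‖ ^ 2 ∂μ := integral_nonneg fun a => by positivity
  simp only [ENNReal.toReal_ofNat, Real.rpow_two]
  rw [ENNReal.toReal_ofReal (by positivity), ← Real.rpow_natCast, ← Real.rpow_mul h0]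
  norm_num

theorem Continuous.memLp_two_restrict_Ico {F : Type*} [NormedAddCommGroup F] {f : ℝ → F}
    (hf : Continuous f) (a b : ℝ) : MemLp f 2 (volume.restrict (Ico a b)) := by
  obtain ⟨C, hC⟩ := isCompact_Icc.exists_bound_of_continuousOn (s := Icc a b) hf.continuousOn
  refine MemLp.of_bound hf.aestronglyMeasurable C ?_
  filter_upwards [ae_restrict_mem measurableSet_Ico] with t ht
  exact hC t (Ico_subset_Icc_self ht)

theorem sq_norm_integral_le {F : Type*} [NormedAddCommGroup F] [NormedSpace ℝ F] {f : ℝ → F}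
    (hf : Continuous f) {τ : ℝ} (hτ : 0 < τ) :
    ‖∫ t in (0 : ℝ)..τ, f t‖ ^ 2 ≤ τ * ∫ t in (0 : ℝ)..τ, ‖f t‖ ^ 2 := by
  have hi : ∀ g : ℝ → ℝ, Continuous g → IntervalIntegrable g volume 0 τ :=
    fun g hg => hg.intervalIntegrable _ _
  set c := ∫ t in (0 : ℝ)..τ, ‖f t‖ with hc
  have h1 : ‖∫ t in (0 : ℝ)..τ, f t‖ ≤ c := intervalIntegral.norm_integral_le_integral_norm hτ.le
  -- Cauchy–Schwarz as the nonnegativity of a variance: `c / τ` is the mean of `‖f‖`.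
  have h2 : 0 ≤ ∫ t in (0 : ℝ)..τ, (τ * ‖f t‖ - c) ^ 2 :=
    intervalIntegral.integral_nonneg hτ.le fun t _ => sq_nonneg _
  have h3 : ∫ t in (0 : ℝ)..τ, (τ * ‖f t‖ - c) ^ 2 =
      τ ^ 2 * (∫ t in (0 : ℝ)..τ, ‖f t‖ ^ 2) - 2 * τ * c * c + τ * c ^ 2 := by
    have : ∀ t, (τ * ‖f t‖ - c) ^ 2 = τ ^ 2 * ‖f t‖ ^ 2 - 2 * τ * c * ‖f t‖ + c ^ 2 := by
      intro t; ring
    simp only [this]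
    rw [intervalIntegral.integral_add (hi _ (by fun_prop)) (hi _ (by fun_prop)),
      intervalIntegral.integral_sub (hi _ (by fun_prop)) (hi _ (by fun_prop)),
      intervalIntegral.integral_const_mul, intervalIntegral.integral_const_mul, ← hc]
    simp
  have h4 : 0 ≤ τ * (τ * (∫ t in (0 : ℝ)..τ, ‖f t‖ ^ 2) - c ^ 2) := by nlinarith
  have h5 := nonneg_of_mul_nonneg_right h4 hτ
  nlinarith [norm_nonneg (∫ t in (0 : ℝ)..τ, f t)]

/-- The function factors as `e^{-s(t-τ)}` times `s / (e^{sτ} - 1)`. The first factor decreases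
because `τ ≤ t`, the second because the exponential is convex. -/
theorem antitoneOn_mul_exp_div {τ t : ℝ} (hτ : 0 < τ) (ht : τ ≤ t) :
    AntitoneOn (fun s : ℝ => s * Real.exp (-(s * t)) / (1 - Real.exp (-(s * τ)))) (Ioi 0) := by
  have hpos : ∀ s : ℝ, 0 < s → 0 < Real.exp (s * τ) - 1 := fun s hs => by
    have := Real.add_one_lt_exp (mul_pos hs hτ).ne'
    nlinarith [mul_pos hs hτ]
  have hform : ∀ s : ℝ, 0 < s → s * Real.exp (-(s * t)) / (1 - Real.exp (-(s * τ))) =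
      Real.exp (-(s * (t - τ))) * (s / (Real.exp (s * τ) - 1)) := by
    intro s hs
    have h1 := hpos s hs
    have h2 : 1 - Real.exp (-(s * τ)) = Real.exp (-(s * τ)) * (Real.exp (s * τ) - 1) := by
      rw [mul_sub, ← Real.exp_add]
      simp
    have h3 : Real.exp (-(s * t)) = Real.exp (-(s * (t - τ))) * Real.exp (-(s * τ)) := by
      rw [← Real.exp_add]
      ring_nf
    rw [h2, h3]
    field_simp
  intro s (hs : 0 < s) r (hr : 0 < r) hsr
  simp only [hform s hs, hform r hr]
  refine mul_le_mul (Real.exp_le_exp.2 (neg_le_neg (mul_le_mul_of_nonneg_right hsr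
    (sub_nonneg.2 ht)))) ?_ (div_nonneg hr.le (hpos r hr).le) (Real.exp_nonneg _)
  rw [div_le_div_iff₀ (hpos r hr) (hpos s hs)]
  -- Convexity at `s τ`, written as a convex combination of `r τ` and `0` with weight `s / r`.
  have hc := convexOn_exp.2 (mem_univ (r * τ)) (mem_univ 0) (div_nonneg hs.le hr.le)
    (sub_nonneg.2 ((div_le_one hr).2 hsr)) (by ring)
  simp only [smul_eq_mul, mul_zero, add_zero, Real.exp_zero, mul_one] at hc
  rw [show s / r * (r * τ) = s * τ by field_simp] at hc
  have := mul_le_mul_of_nonneg_left hc hr.le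
  have h6 : r * (s / r * Real.exp (r * τ) + (1 - s / r)) = s * Real.exp (r * τ) + (r - s) := by
    field_simp
  rw [h6] at this
  linarith

section Transfer

variable {X : Type*} [NormedAddCommGroup X] [NormedSpace ℂ X] [CompleteSpace X]
  {p : ℕ → X →L[ℂ] X} {b : ℕ → ℝ}

theorem MaximalRegularity.exists_integral_le (hp : IsCoordinateProjections p) {B : X →ₗ.[ℂ] X}
    (hB : ∀ x y, (x, y) ∈ B.graph → ∀ k, p k y = (b k : ℂ) • p k x) {T : ℝ} (hT : 0 < T)
    (h : MaximalRegularity T B) :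
    ∃ C : ℝ, 0 ≤ C ∧ ∀ u v w : ℝ → X, u 0 = 0 → (∀ t, HasDerivAt u (v t) t) → Continuous v →
      Continuous w → (∀ t, (u t, w t) ∈ B.graph) →
      ∫ t in (0 : ℝ)..T, ‖w t‖ ^ 2 ≤ C * ∫ t in (0 : ℝ)..T, ‖v t + w t‖ ^ 2 := by
  obtain ⟨C, hC0, hC⟩ := h.exists_norm_le hp hB
  refine ⟨C ^ 2, sq_nonneg C, fun u v w hu0 hu hv hw huw => ?_⟩
  have huc : Continuous u := continuous_iff_continuousAt.2 fun t => (hu t).continuousAt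
  have hu2 := huc.memLp_two_restrict_Ico 0 T
  have hv2 := hv.memLp_two_restrict_Ico 0 T
  have hw2 := hw.memLp_two_restrict_Ico 0 T
  have h1 : HasTimeDeriv (hu2.toLp u) (hv2.toLp v) := by
    have hae := (hv2.coeFn_toLp : _ =ᵐ[_] _)
    filter_upwards [hu2.coeFn_toLp, ae_restrict_mem measurableSet_Ico] with t ht htm
    have h2 : ∫ s in (0 : ℝ)..t, (hv2.toLp v) s = ∫ s in (0 : ℝ)..t, v s := by
      rw [intervalIntegral.integral_of_le htm.1, intervalIntegral.integral_of_le htm.1]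
      refine integral_congr_ae (ae_restrict_of_ae_restrict_of_subset ?_ hae)
      exact fun s hs => ⟨hs.1.le, hs.2.trans_lt htm.2⟩
    rw [ht, h2, intervalIntegral.integral_eq_sub_of_hasDerivAt (fun s _ => hu s)
      (hv.intervalIntegrable _ _), hu0, sub_zero]
  have h2 : HasTimeApply B (hu2.toLp u) (hw2.toLp w) := by
    filter_upwards [hu2.coeFn_toLp, hw2.coeFn_toLp] with t h3 h4
    rw [h3, h4]
    exact huw t
  have h3 := hC _ _ _ h1 h2
  rw [← MemLp.toLp_add] at h3
  have h4 := pow_le_pow_left₀ (norm_nonneg _) h3 2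
  rw [mul_pow, norm_toLp_two_sq, norm_toLp_two_sq] at h4
  rw [intervalIntegral.integral_of_le hT.le, intervalIntegral.integral_of_le hT.le,
    ← integral_Ico_eq_integral_Ioc, ← integral_Ico_eq_integral_Ioc]
  exact h4

end Transfer

section Multiplier

variable {X : Type*} [NormedAddCommGroup X] [NormedSpace ℂ X] {p : ℕ → X →L[ℂ] X} {b : ℕ → ℝ}

/-- This bounds `B e^{-tB} (1 - e^{-τB})⁻¹` uniformly for `t ≥ τ`: its eigenvalues are decreasing in
`b k`, so Abel summation applies and the first one, at worst at `t = τ`, is the constant. -/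
theorem IsCoordinateProjections.norm_sum_exp_smul_le (hp : IsCoordinateProjections p) {K : ℝ}
    (hK : ∀ n, ‖∑ k ∈ Finset.range n, p k‖ ≤ K) (hb : Monotone b) (hb0 : ∀ k, 0 < b k)
    {τ t : ℝ} (hτ : 0 < τ) (ht : τ ≤ t) (y : ℕ → X) (m : ℕ) :
    ‖∑ k ∈ Finset.range m, (b k * Complex.exp (-(b k * t)) : ℂ) • p k (y k)‖ ≤
      b 0 * Real.exp (-(b 0 * τ)) / (1 - Real.exp (-(b 0 * τ))) *
        (K * ‖∑ k ∈ Finset.range m, (1 - Complex.exp (-(b k * τ)) : ℂ) • p k (y k)‖) := by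
  set x := ∑ k ∈ Finset.range m, (1 - Complex.exp (-(b k * τ)) : ℂ) • p k (y k) with hx
  have hpos : ∀ k, 0 < 1 - Real.exp (-(b k * τ)) := fun k =>
    sub_pos.2 (Real.exp_lt_one_iff.2 (neg_neg_iff_pos.2 (mul_pos (hb0 k) hτ)))
  set c : ℕ → ℝ := fun k => b k * Real.exp (-(b k * t)) / (1 - Real.exp (-(b k * τ))) with hc
  have hca : Antitone c := fun k l hkl => antitoneOn_mul_exp_div hτ ht (hb0 k) (hb0 l) (hb hkl)
  have hc0 : ∀ k, 0 ≤ c k := fun k =>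
    div_nonneg (mul_nonneg (hb0 k).le (Real.exp_nonneg _)) (hpos k).le
  have hpx : ∀ k ∈ Finset.range m, p k x = (1 - Complex.exp (-(b k * τ)) : ℂ) • p k (y k) := by
    intro k hk
    have := hp.apply_sum (fun l => (1 - Complex.exp (-(b l * τ)) : ℂ) • y l) k m
    simp only [map_smul, if_pos (Finset.mem_range.1 hk)] at this
    rw [hx, this]
  have hsum : ∑ k ∈ Finset.range m, (b k * Complex.exp (-(b k * t)) : ℂ) • p k (y k) =
      ∑ k ∈ Finset.range m, (c k : ℂ) • p k x := by
    refine Finset.sum_congr rfl fun k hk => ?_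
    rw [hpx k hk, smul_smul]
    congr 1
    have h1 : ((1 - Real.exp (-(b k * τ)) : ℝ) : ℂ) ≠ 0 := Complex.ofReal_ne_zero.2 (hpos k).ne'
    simp only [hc]
    push_cast at h1 ⊢
    field_simp
  have hKx : ∀ n, ‖∑ k ∈ Finset.range n, p k x‖ ≤ K * ‖x‖ := fun n => by
    rw [← sum_apply]
    exact (ContinuousLinearMap.le_opNorm _ _).trans
      (mul_le_mul_of_nonneg_right (hK n) (norm_nonneg _))
  rw [hsum]
  refine (norm_sum_range_smul_le_of_antitone hca hc0 hKx m).trans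
    (mul_le_mul_of_nonneg_right ?_ ((norm_nonneg _).trans (hKx 0)))
  refine div_le_div_of_nonneg_right (mul_le_mul_of_nonneg_left (Real.exp_le_exp.2 ?_) (hb0 0).le)
    (hpos 0).le
  exact neg_le_neg (mul_le_mul_of_nonneg_left ht (hb0 0).le)

/-- The Fourier multiplier `ν ↦ b (b + iν)⁻¹` applied to the trigonometric polynomial
`∑ exp (i ν_j t) f_j`. -/
noncomputable def resolventPolynomial {ι : Type*} (p : ℕ → X →L[ℂ] X) (b : ℕ → ℝ) (ν : ι → ℝ)
    (J : Finset ι) (f : ι → X) (m : ℕ) (t : ℝ) : X :=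
  ∑ k ∈ Finset.range m, p k (∑ j ∈ J,
    (b k / (b k + Complex.I * ν j) * Complex.exp (Complex.I * ν j * t) : ℂ) • f j)

variable [CompleteSpace X]

/-- The periodic solution equals the solution `u` with `u 0 = 0` plus `e^{-tB} y`, where `y` is the
periodic solution's initial value. Periodicity of the forcing gives `u τ = (1 - e^{-τB}) y`, so on
`[τ, 2τ]` the correction `B e^{-tB} y` is controlled by `u τ`, and `u τ` by the `L²` norm of `u'`.
All of this is explicit on finite sums. -/
theorem HasMRP.exists_integral_resolventPolynomial_le (hp : IsCoordinateProjections p)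
    (hb : Monotone b) (hb0 : ∀ k, 0 < b k) (hb' : Tendsto b atTop atTop) {τ : ℝ} (hτ : 0 < τ)
    (hX : HasMRP (2 * τ) X) :
    ∃ D : ℝ, 0 ≤ D ∧ ∀ {ι : Type} (ν : ι → ℝ)
      (_ : ∀ j, Complex.exp (Complex.I * ν j * τ) = 1) (J : Finset ι) (f : ι → X) (m : ℕ),
      ∫ t in τ..(2 * τ), ‖resolventPolynomial p b ν J f m t‖ ^ 2 ≤
        D * ∫ t in (0 : ℝ)..(2 * τ), ‖∑ k ∈ Finset.range m,
          p k (∑ j ∈ J, Complex.exp (Complex.I * ν j * t) • f j)‖ ^ 2 := by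
  obtain ⟨K, hK0, hK⟩ := hp.exists_norm_sum_le
  obtain ⟨B, hBgen, hB1, hB2⟩ := exists_diagonal_operator hp hb hb0 hb'
  obtain ⟨C, hC0, hC⟩ := (hX B hBgen).exists_integral_le hp hB1 (by linarith)
  set L : ℝ := b 0 * Real.exp (-(b 0 * τ)) / (1 - Real.exp (-(b 0 * τ))) with hL
  have hL0 : 0 ≤ L := div_nonneg (mul_nonneg (hb0 0).le (Real.exp_nonneg _))
    (sub_nonneg.2 (Real.exp_le_one_iff.2 (neg_nonpos.2 (mul_pos (hb0 0) hτ).le)))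
  -- The term `2 * C` comes from `B u`. The other collects `2 (L K)²`, the length `τ` of the
  -- interval, and the bound `2 τ (1 + C)` for `‖u τ‖²`.
  refine ⟨2 * C + 4 * τ ^ 2 * (L * K) ^ 2 * (1 + C), by positivity, fun {ι} ν hν J f m => ?_⟩
  have hden : ∀ k j, (b k + Complex.I * ν j : ℂ) ≠ 0 := fun k j h => by
    have := congrArg Complex.re h
    simp at this
    exact (hb0 k).ne' this
  -- The scalar solutions of `a' + b k • a = ∑ exp (i ν_j t) f_j` vanishing at `0`; the projection
  -- `p k` is applied afterwards.
  let a : ℕ → ℝ → X := fun k t => ∑ j ∈ J, ((b k + Complex.I * ν j : ℂ)⁻¹ *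
    (Complex.exp (Complex.I * ν j * t) - Complex.exp (-(b k * t)))) • f j
  let a' : ℕ → ℝ → X := fun k t => ∑ j ∈ J, ((b k + Complex.I * ν j : ℂ)⁻¹ *
    (Complex.I * ν j * Complex.exp (Complex.I * ν j * t) + b k * Complex.exp (-(b k * t)))) • f j
  let y : ℕ → X := fun k => ∑ j ∈ J, (b k + Complex.I * ν j : ℂ)⁻¹ • f j
  let u : ℝ → X := fun t => ∑ k ∈ Finset.range m, p k (a k t)
  let v : ℝ → X := fun t => ∑ k ∈ Finset.range m, p k (a' k t)
  let w : ℝ → X := fun t => ∑ k ∈ Finset.range m, (b k : ℂ) • p k (a k t)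
  let F : ℝ → X := fun t => ∑ k ∈ Finset.range m,
    p k (∑ j ∈ J, Complex.exp (Complex.I * ν j * t) • f j)
  have hac : ∀ k, Continuous (a k) := fun k => by fun_prop
  have hvc : Continuous v := by fun_prop
  have hwc : Continuous w := by fun_prop
  have hFc : Continuous F := by fun_prop
  have hGc : Continuous (resolventPolynomial p b ν J f m) := by
    unfold resolventPolynomial; fun_prop
  have ha : ∀ k t, HasDerivAt (a k) (a' k t) t := by
    intro k t
    refine HasDerivAt.fun_sum fun j _ => HasDerivAt.smul_const (HasDerivAt.const_mul _ ?_) _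
    have h1 := (((hasDerivAt_id t).ofReal_comp).const_mul (Complex.I * ν j)).cexp
    have h2 := (((hasDerivAt_id t).ofReal_comp).const_mul (b k : ℂ)).neg.cexp
    convert! h1.sub h2 using 1
    simp
    ring
  have hu : ∀ t, HasDerivAt u (v t) t := fun t =>
    HasDerivAt.fun_sum fun k _ =>
      ((p k).restrictScalars ℝ).hasFDerivAt.comp_hasDerivAt t (ha k t)
  have hu0 : u 0 = 0 := by simp [u, a]
  have hgraph : ∀ t, (u t, w t) ∈ B.graph := by
    intro t
    have : (u t, w t) = ∑ k ∈ Finset.range m, (p k (a k t), (b k : ℂ) • p k (a k t)) := by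
      rw [Prod.ext_iff, Prod.fst_sum, Prod.snd_sum]
      exact ⟨rfl, rfl⟩
    rw [this]
    exact Submodule.sum_mem _ fun k _ => hB2 k _
  have hvw : ∀ t, v t + w t = F t := by
    intro t
    simp only [v, w, F, ← Finset.sum_add_distrib]
    refine Finset.sum_congr rfl fun k _ => ?_
    rw [← map_smul, ← map_add]
    congr 1
    simp only [a, a', Finset.smul_sum, ← Finset.sum_add_distrib, smul_smul, ← add_smul]
    refine Finset.sum_congr rfl fun j _ => ?_
    congr 1
    have := hden k j
    field_simp
    ring
  have hG : ∀ t, resolventPolynomial p b ν J f m t = w t +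
      ∑ k ∈ Finset.range m, (b k * Complex.exp (-(b k * t)) : ℂ) • p k (y k) := by
    intro t
    simp only [resolventPolynomial, w, ← Finset.sum_add_distrib]
    refine Finset.sum_congr rfl fun k _ => ?_
    rw [← map_smul, ← map_smul, ← map_add]
    congr 1
    simp only [a, y, Finset.smul_sum, ← Finset.sum_add_distrib, smul_smul, ← add_smul]
    refine Finset.sum_congr rfl fun j _ => ?_
    congr 1
    have := hden k j
    field_simp
    ring
  -- The hypothesis `hν` enters here: every exponential returns to `1` at time `τ`.
  have huτ : u τ = ∑ k ∈ Finset.range m, (1 - Complex.exp (-(b k * τ)) : ℂ) • p k (y k) := by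
    refine Finset.sum_congr rfl fun k _ => ?_
    rw [← map_smul]
    congr 1
    simp only [a, y, Finset.smul_sum, smul_smul, hν]
    refine Finset.sum_congr rfl fun j _ => ?_
    rw [mul_comm]
  have hii : ∀ g : ℝ → ℝ, Continuous g → ∀ s t, IntervalIntegrable g volume s t :=
    fun g hg s t => hg.intervalIntegrable _ _
  have hIw : ∫ t in (0 : ℝ)..(2 * τ), ‖w t‖ ^ 2 ≤ C * ∫ t in (0 : ℝ)..(2 * τ), ‖F t‖ ^ 2 := by
    have := hC u v w hu0 hu hvc hwc hgraph
    simpa only [hvw] using this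
  have hIv : ∫ t in (0 : ℝ)..(2 * τ), ‖v t‖ ^ 2 ≤
      2 * (1 + C) * ∫ t in (0 : ℝ)..(2 * τ), ‖F t‖ ^ 2 := by
    have h1 : ∫ t in (0 : ℝ)..(2 * τ), ‖v t‖ ^ 2 ≤
        ∫ t in (0 : ℝ)..(2 * τ), (2 * ‖F t‖ ^ 2 + 2 * ‖w t‖ ^ 2) := by
      refine intervalIntegral.integral_mono_on (by linarith) (hii _ (by fun_prop) _ _)
        (hii _ (by fun_prop) _ _) fun t _ => ?_
      have h2 : ‖v t‖ ≤ ‖F t‖ + ‖w t‖ := by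
        rw [← hvw t]
        simpa using norm_sub_le (v t + w t) (w t)
      nlinarith [norm_nonneg (v t), sq_nonneg (‖F t‖ - ‖w t‖)]
    rw [intervalIntegral.integral_add (hii _ (by fun_prop) _ _) (hii _ (by fun_prop) _ _),
      intervalIntegral.integral_const_mul, intervalIntegral.integral_const_mul] at h1
    linarith
  have hsub : ∀ g : ℝ → ℝ, Continuous g → (∀ t, 0 ≤ g t) → ∀ s t, 0 ≤ s → s ≤ t → t ≤ 2 * τ →
      ∫ r in s..t, g r ≤ ∫ r in (0 : ℝ)..(2 * τ), g r := by
    intro g hg hg0 s t h0 hst h2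
    exact intervalIntegral.integral_mono_interval h0 hst h2 (Eventually.of_forall hg0)
      (hii g hg _ _)
  have huN : ‖u τ‖ ^ 2 ≤ τ * (2 * (1 + C) * ∫ t in (0 : ℝ)..(2 * τ), ‖F t‖ ^ 2) := by
    have h1 : u τ = ∫ t in (0 : ℝ)..τ, v t := by
      rw [intervalIntegral.integral_eq_sub_of_hasDerivAt (fun s _ => hu s)
        (hvc.intervalIntegrable _ _), hu0, sub_zero]
    rw [h1]
    refine (sq_norm_integral_le hvc hτ).trans (mul_le_mul_of_nonneg_left (le_trans ?_ hIv) hτ.le)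
    exact hsub (fun t => ‖v t‖ ^ 2) (by fun_prop) (fun t => by positivity) 0 τ le_rfl hτ.le
      (by linarith)
  have hI0 : 0 ≤ ∫ t in (0 : ℝ)..(2 * τ), ‖F t‖ ^ 2 :=
    intervalIntegral.integral_nonneg (by linarith) fun t _ => by positivity
  have hGle : ∫ t in τ..(2 * τ), ‖resolventPolynomial p b ν J f m t‖ ^ 2 ≤
      ∫ t in τ..(2 * τ), (2 * ‖w t‖ ^ 2 + 2 * (L * K) ^ 2 * ‖u τ‖ ^ 2) := by
    refine intervalIntegral.integral_mono_on (by linarith) (hii _ (by fun_prop) _ _)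
      (hii _ (by fun_prop) _ _) fun t ht => ?_
    have h1 := hp.norm_sum_exp_smul_le hK hb hb0 hτ ht.1 y m
    rw [← huτ, ← hL] at h1
    have h2 : ‖resolventPolynomial p b ν J f m t‖ ≤ ‖w t‖ + L * (K * ‖u τ‖) := by
      rw [hG t]
      exact (norm_add_le _ _).trans (add_le_add_right h1 _)
    have h3 := pow_le_pow_left₀ (norm_nonneg _) h2 2
    nlinarith [sq_nonneg (‖w t‖ - L * (K * ‖u τ‖))]
  rw [intervalIntegral.integral_add (hii _ (by fun_prop) _ _) (hii _ (by fun_prop) _ _),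
    intervalIntegral.integral_const_mul, intervalIntegral.integral_const, smul_eq_mul] at hGle
  have hw' := hsub (fun t => ‖w t‖ ^ 2) (by fun_prop) (fun t => by positivity) τ (2 * τ) hτ.le
    (by linarith) le_rfl
  have hlast : (2 * τ - τ) * (2 * (L * K) ^ 2 * ‖u τ‖ ^ 2) ≤
      (2 * τ - τ) * (2 * (L * K) ^ 2 * (τ * (2 * (1 + C) * ∫ t in (0 : ℝ)..(2 * τ), ‖F t‖ ^ 2))) := by
    have : 0 ≤ 2 * τ - τ := by linarith
    gcongr
  change _ ≤ _ * ∫ t in (0 : ℝ)..(2 * τ), ‖F t‖ ^ 2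
  calc _ ≤ _ := hGle
    _ ≤ 2 * (C * ∫ t in (0 : ℝ)..(2 * τ), ‖F t‖ ^ 2) + (2 * τ - τ) * (2 * (L * K) ^ 2 *
        (τ * (2 * (1 + C) * ∫ t in (0 : ℝ)..(2 * τ), ‖F t‖ ^ 2))) :=
      add_le_add (mul_le_mul_of_nonneg_left (hw'.trans hIw) zero_le_two) hlast
    _ = _ := by ring

end Multiplier

/-! ### The dyadic multiplier on the circle -/

instance fact_two_pi_pos : Fact (0 < 2 * Real.pi) := ⟨Real.two_pi_pos⟩

/-- The trigonometric polynomial `∑ exp (i ν_j t) x_j` on the circle. -/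
noncomputable def trigPolynomial {ι Y : Type*} [NormedAddCommGroup Y] [NormedSpace ℂ Y]
    (ν : ι → ℤ) (J : Finset ι) (x : ι → Y) (t : AddCircle (2 * Real.pi)) : Y :=
  ∑ j ∈ J, fourier (ν j) t • x j

/-- The `L²` norm of a function on the circle with respect to the normalized Haar measure. -/
noncomputable def circleNorm {Y : Type*} [NormedAddCommGroup Y]
    (f : AddCircle (2 * Real.pi) → Y) : ℝ :=
  Real.sqrt (∫ t, ‖f t‖ ^ 2 ∂AddCircle.haarAddCircle)

/-- The dyadic eigenvalues, chosen so that `(2 n - 1)`-th and `2 n`-th projections are paired with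
`2 ^ (n - 1)` and `2 ^ n`. -/
noncomputable def dyadicEigenvalue (k : ℕ) : ℝ := 2 ^ ((k + 1) / 2)

theorem dyadicEigenvalue_pos (k : ℕ) : 0 < dyadicEigenvalue k := by
  unfold dyadicEigenvalue; positivity

theorem monotone_dyadicEigenvalue : Monotone dyadicEigenvalue := fun k l hkl =>
  pow_le_pow_right₀ one_le_two (Nat.div_le_div_right (by omega))

theorem tendsto_dyadicEigenvalue : Tendsto dyadicEigenvalue atTop atTop := by
  refine (tendsto_pow_atTop_atTop_of_one_lt one_lt_two).comp ?_
  exact (Nat.tendsto_div_const_atTop two_ne_zero).comp (tendsto_add_atTop_nat 1)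

theorem fourier_two_pi_coe (n : ℤ) (t : ℝ) :
    fourier n (t : AddCircle (2 * Real.pi)) = Complex.exp (Complex.I * n * t) := by
  rw [fourier_coe_apply]
  congr 1
  have : (Real.pi : ℂ) ≠ 0 := Complex.ofReal_ne_zero.2 Real.pi_ne_zero
  push_cast
  field_simp

theorem continuous_trigPolynomial {ι Y : Type*} [NormedAddCommGroup Y] [NormedSpace ℂ Y]
    (ν : ι → ℤ) (J : Finset ι) (x : ι → Y) : Continuous (trigPolynomial ν J x) := by
  unfold trigPolynomial; fun_prop

theorem intervalIntegral_eq_haarAddCircle (a : ℝ) (g : AddCircle (2 * Real.pi) → ℝ) :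
    ∫ t in a..(a + 2 * Real.pi), g t = 2 * Real.pi * ∫ t, g t ∂AddCircle.haarAddCircle := by
  rw [AddCircle.intervalIntegral_preimage, AddCircle.integral_haarAddCircle, smul_eq_mul,
    mul_inv_cancel_left₀ Real.two_pi_pos.ne']

theorem lacunaryNorm_eq_circleNorm {Y : Type*} [NormedAddCommGroup Y] [NormedSpace ℂ Y] (N : ℕ)
    (y : ℕ → Y) :
    lacunaryNorm N y = circleNorm (trigPolynomial (fun n : ℕ => 2 ^ n) (Finset.Icc 1 N) y) := by
  have h := intervalIntegral_eq_haarAddCircle 0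
    (fun t => ‖trigPolynomial (fun n : ℕ => 2 ^ n) (Finset.Icc 1 N) y t‖ ^ 2)
  rw [zero_add] at h
  unfold lacunaryNorm circleNorm
  congr 1
  rw [intervalIntegral.integral_div, div_eq_iff Real.two_pi_pos.ne']
  refine Eq.trans ?_ (h.trans (mul_comm _ _))
  simp only [trigPolynomial, fourier_two_pi_coe]
  push_cast
  rfl

/-- The Fourier multiplier `j ↦ ∑_{k < m} c_k (c_k + i j)⁻¹ p_k`, with dyadic `c_k`, applied to a
trigonometric polynomial. -/
noncomputable def dyadicMultiplier {ι X : Type*} [NormedAddCommGroup X] [NormedSpace ℂ X]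
    (p : ℕ → X →L[ℂ] X) (ν : ι → ℤ) (J : Finset ι) (f : ι → X) (m : ℕ)
    (t : AddCircle (2 * Real.pi)) : X :=
  ∑ k ∈ Finset.range m, p k (∑ j ∈ J,
    (dyadicEigenvalue k / (dyadicEigenvalue k + Complex.I * ν j) * fourier (ν j) t : ℂ) • f j)

section Circle

variable {X : Type*} [NormedAddCommGroup X] [NormedSpace ℂ X] {p : ℕ → X →L[ℂ] X}

theorem continuous_dyadicMultiplier {ι : Type*} (ν : ι → ℤ) (J : Finset ι) (f : ι → X) (m : ℕ) :
    Continuous (dyadicMultiplier p ν J f m) := by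
  unfold dyadicMultiplier; fun_prop

theorem integral_comp_mul_coe_addCircle {τ : ℝ} (hτ : 0 < τ) (n : ℕ)
    (g : AddCircle (2 * Real.pi) → ℝ) :
    ∫ t in (n * τ)..((n + 1) * τ), g ((2 * Real.pi / τ * t : ℝ) : AddCircle (2 * Real.pi)) =
      τ * ∫ t, g t ∂AddCircle.haarAddCircle := by
  have hω : 2 * Real.pi / τ ≠ 0 := (div_pos Real.two_pi_pos hτ).ne'
  rw [intervalIntegral.integral_comp_mul_left (fun t : ℝ => g (t : AddCircle (2 * Real.pi))) hω,
    show 2 * Real.pi / τ * ((n + 1) * τ) = 2 * Real.pi / τ * (n * τ) + 2 * Real.pi by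
      field_simp, intervalIntegral_eq_haarAddCircle, smul_eq_mul, ← mul_assoc]
  congr 1
  have := Real.pi_ne_zero
  field_simp

variable [CompleteSpace X]

/-- Scaling time by `ω = 2π/τ`, with `T = 2τ`, makes one turn of the circle last `τ`. Eigenvalues
and frequencies are both multiplied by `ω`, which leaves the multiplier symbol unchanged, so `T`
affects only the constant. -/
theorem HasMRP.exists_circleNorm_dyadicMultiplier_le (hp : IsCoordinateProjections p)
    {T : ℝ} (hT : 0 < T) (hX : HasMRP T X) :
    ∃ D : ℝ, 0 ≤ D ∧ ∀ {ι : Type} (ν : ι → ℤ) (J : Finset ι) (f : ι → X) (m : ℕ),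
      circleNorm (dyadicMultiplier p ν J f m) ≤ D * circleNorm (trigPolynomial ν J f) := by
  obtain ⟨K, hK0, hK⟩ := hp.exists_norm_sum_le
  obtain ⟨τ, rfl⟩ : ∃ τ, T = 2 * τ := ⟨T / 2, by ring⟩
  have hτ : 0 < τ := by linarith
  set ω : ℝ := 2 * Real.pi / τ with hω
  have hω0 : 0 < ω := div_pos Real.two_pi_pos hτ
  obtain ⟨D, hD0, hD⟩ := hX.exists_integral_resolventPolynomial_le hp
    (b := fun k => ω * dyadicEigenvalue k)
    (monotone_dyadicEigenvalue.const_mul hω0.le) (fun k => mul_pos hω0 (dyadicEigenvalue_pos k))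
    (tendsto_dyadicEigenvalue.const_mul_atTop hω0) hτ
  -- The `2` counts the periods in `[0, 2τ]`; `K` bounds the partial sum of projections truncating
  -- the forcing.
  refine ⟨Real.sqrt (2 * D * K ^ 2), Real.sqrt_nonneg _, fun {ι} ν J f m => ?_⟩
  have h := hD (fun j => ω * ν j) (fun j => ?_) J f m
  swap
  · rw [Complex.exp_eq_one_iff]
    refine ⟨ν j, ?_⟩
    have : (τ : ℂ) ≠ 0 := Complex.ofReal_ne_zero.2 hτ.ne'
    rw [hω]
    push_cast
    field_simp
  have h1 : ∀ t : ℝ, resolventPolynomial p (fun k => ω * dyadicEigenvalue k) (fun j => ω * ν j)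
      J f m t = dyadicMultiplier p ν J f m (ω * t : ℝ) := by
    intro t
    simp only [resolventPolynomial, dyadicMultiplier, fourier_two_pi_coe]
    refine Finset.sum_congr rfl fun k _ => ?_
    congr 1
    refine Finset.sum_congr rfl fun j _ => ?_
    congr 1
    have h2 : (ω : ℂ) ≠ 0 := Complex.ofReal_ne_zero.2 hω0.ne'
    push_cast
    rw [show (ω * dyadicEigenvalue k + Complex.I * (ω * ν j) : ℂ) =
      ω * (dyadicEigenvalue k + Complex.I * ν j) by ring, mul_div_mul_left _ _ h2]
    congr 2
    ring
  have h2 : ∀ t : ℝ, ∑ j ∈ J, Complex.exp (Complex.I * (ω * ν j : ℝ) * t) • f j =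
      trigPolynomial ν J f (ω * t : ℝ) := by
    intro t
    simp only [trigPolynomial, fourier_two_pi_coe]
    refine Finset.sum_congr rfl fun j _ => ?_
    congr 2
    push_cast
    ring
  simp only [h1, h2] at h
  have h3 : ∫ t in (0 : ℝ)..(2 * τ), ‖∑ k ∈ Finset.range m,
      p k (trigPolynomial ν J f (ω * t : ℝ))‖ ^ 2 ≤
      ∫ t in (0 : ℝ)..(2 * τ), K ^ 2 * ‖trigPolynomial ν J f (ω * t : ℝ)‖ ^ 2 := by
    have hc : Continuous fun t : ℝ => trigPolynomial ν J f (ω * t : ℝ) :=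
      (continuous_trigPolynomial ν J f).comp
        ((AddCircle.continuous_mk' _).comp (continuous_const.mul continuous_id))
    refine intervalIntegral.integral_mono_on (by linarith)
      (Continuous.intervalIntegrable (by fun_prop) _ _)
      (Continuous.intervalIntegrable (by fun_prop) _ _) fun t _ => ?_
    rw [← mul_pow, ← sum_apply]
    exact pow_le_pow_left₀ (norm_nonneg _) ((ContinuousLinearMap.le_opNorm _ _).trans
      (mul_le_mul_of_nonneg_right (hK m) (norm_nonneg _))) 2
  have hc : Continuous fun t : ℝ => ‖trigPolynomial ν J f (ω * t : ℝ)‖ ^ 2 :=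
    ((continuous_trigPolynomial ν J f).comp
        ((AddCircle.continuous_mk' _).comp (continuous_const.mul continuous_id))).norm.pow 2
  have h4 := integral_comp_mul_coe_addCircle hτ 0 (fun t => ‖trigPolynomial ν J f t‖ ^ 2)
  have h5 := integral_comp_mul_coe_addCircle hτ 1 (fun t => ‖trigPolynomial ν J f t‖ ^ 2)
  have h6 := integral_comp_mul_coe_addCircle hτ 1 (fun t => ‖dyadicMultiplier p ν J f m t‖ ^ 2)
  norm_num at h4 h5 h6
  rw [← hω] at h4 h5 h6
  have h7 := intervalIntegral.integral_add_adjacent_intervals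
    (hc.intervalIntegrable 0 τ) (hc.intervalIntegrable τ (2 * τ)) (μ := volume)
  rw [intervalIntegral.integral_const_mul, ← h7, h4, h5] at h3
  rw [h6] at h
  have h8 := h.trans (mul_le_mul_of_nonneg_left h3 hD0)
  unfold circleNorm
  rw [← Real.sqrt_mul (by positivity)]
  refine Real.sqrt_le_sqrt (le_of_mul_le_mul_left (h8.trans_eq ?_) hτ)
  ring

end Circle

/-! ### `L²` on the circle: density and duality -/

section CircleNorm

variable {Y : Type*} [NormedAddCommGroup Y]

theorem Continuous.memLp_two_haarAddCircle {f : AddCircle (2 * Real.pi) → Y} (hf : Continuous f) :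
    MemLp f 2 AddCircle.haarAddCircle := by
  obtain ⟨C, hC⟩ := isCompact_univ.exists_bound_of_continuousOn hf.continuousOn
  exact MemLp.of_bound hf.aestronglyMeasurable C
    (Eventually.of_forall fun t => hC t (mem_univ t))

theorem circleNorm_eq_norm_toLp {f : AddCircle (2 * Real.pi) → Y}
    (hf : MemLp f 2 AddCircle.haarAddCircle) : circleNorm f = ‖hf.toLp f‖ := by
  rw [circleNorm, ← norm_toLp_two_sq hf, Real.sqrt_sq (norm_nonneg _)]

theorem circleNorm_nonneg (f : AddCircle (2 * Real.pi) → Y) : 0 ≤ circleNorm f :=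
  Real.sqrt_nonneg _

theorem circleNorm_add_le {f g : AddCircle (2 * Real.pi) → Y} (hf : Continuous f)
    (hg : Continuous g) : circleNorm (f + g) ≤ circleNorm f + circleNorm g := by
  have hf2 := hf.memLp_two_haarAddCircle
  have hg2 := hg.memLp_two_haarAddCircle
  rw [circleNorm_eq_norm_toLp hf2, circleNorm_eq_norm_toLp hg2,
    circleNorm_eq_norm_toLp (hf2.add hg2), MemLp.toLp_add]
  exact norm_add_le _ _

theorem circleNorm_const_smul [NormedSpace ℂ Y] (c : ℂ) (f : AddCircle (2 * Real.pi) → Y) :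
    circleNorm (c • f) = ‖c‖ * circleNorm f := by
  unfold circleNorm
  simp only [Pi.smul_apply, norm_smul, mul_pow]
  rw [integral_const_mul, Real.sqrt_mul (sq_nonneg _), Real.sqrt_sq (norm_nonneg _)]

theorem integral_norm_mul_norm_le {Z : Type*} [NormedAddCommGroup Z]
    {f : AddCircle (2 * Real.pi) → Y} {g : AddCircle (2 * Real.pi) → Z} (hf : Continuous f)
    (hg : Continuous g) :
    ∫ t, ‖f t‖ * ‖g t‖ ∂AddCircle.haarAddCircle ≤ circleNorm f * circleNorm g := by
  have h := integral_mul_le_Lp_mul_Lq_of_nonneg (μ := AddCircle.haarAddCircle (T := 2 * Real.pi))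
    Real.HolderConjugate.two_two
    (Eventually.of_forall fun t => norm_nonneg (f t))
    (Eventually.of_forall fun t => norm_nonneg (g t))
    (by simpa using hf.norm.memLp_two_haarAddCircle)
    (by simpa using hg.norm.memLp_two_haarAddCircle)
  simpa [circleNorm, Real.sqrt_eq_rpow] using h

end CircleNorm

theorem Lp.coeFn_finset_sum {α ι F : Type*} [MeasurableSpace α] {μ : Measure α}
    [NormedAddCommGroup F] {q : ENNReal} (s : Finset ι) (f : ι → Lp F q μ) :
    ((∑ i ∈ s, f i : Lp F q μ) : α → F) =ᵐ[μ] fun t => ∑ i ∈ s, f i t := by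
  classical
  induction s using Finset.induction_on with
  | empty =>
    simp only [Finset.sum_empty]
    exact Lp.coeFn_zero F q μ
  | insert i s hi ih =>
    rw [Finset.sum_insert hi]
    filter_upwards [Lp.coeFn_add (f i) (∑ i ∈ s, f i), ih] with t h1 h2
    rw [h1, Pi.add_apply, h2, Finset.sum_insert hi]

section Density

variable {X : Type*} [NormedAddCommGroup X] [NormedSpace ℂ X]

/-- Trigonometric polynomials are dense in `L²` of the circle. -/
theorem exists_trigPolynomial_circleNorm_sub_lt {f : AddCircle (2 * Real.pi) → X}
    (hf : Continuous f) {ε : ℝ} (hε : 0 < ε) :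
    ∃ (n : ℕ) (ν : Fin n → ℤ) (x : Fin n → X),
      circleNorm (trigPolynomial ν Finset.univ x - f) < ε := by
  let μ : Measure (AddCircle (2 * Real.pi)) := AddCircle.haarAddCircle
  let Ψ : X → Lp ℂ 2 μ →L[ℂ] Lp X 2 μ := fun y =>
    (ContinuousLinearMap.toSpanSingleton ℂ y).compLpL 2 μ
  let s : Set (Lp X 2 μ) := {g | ∃ (j : ℤ) (y : X), g = Ψ y (fourierLp 2 j)}
  have hs : ∀ g : Lp X 2 μ, g ∈ (Submodule.span ℂ s).topologicalClosure := by
    refine Lp.induction ENNReal.ofNat_ne_top _ (fun c S hS hμS => ?_) (fun f g hf hg _ h1 h2 =>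
      Submodule.add_mem _ h1 h2) (Submodule.isClosed_topologicalClosure _)
    have h1 : ∀ φ : Lp ℂ 2 μ, Ψ c φ ∈ (Submodule.span ℂ s).topologicalClosure := by
      intro φ
      have hφ : φ ∈ (Submodule.span ℂ (range (fourierLp (T := 2 * Real.pi) 2))).topologicalClosure := by
        rw [span_fourierLp_closure_eq_top (p := 2) ENNReal.ofNat_ne_top]
        trivial
      have h2 : Submodule.span ℂ (range (fourierLp (T := 2 * Real.pi) 2)) ≤
          (Submodule.span ℂ s).comap (Ψ c : Lp ℂ 2 μ →ₗ[ℂ] Lp X 2 μ) := by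
        rw [Submodule.span_le]
        rintro _ ⟨j, rfl⟩
        exact Submodule.subset_span ⟨j, c, rfl⟩
      exact map_mem_closure (Ψ c).continuous hφ fun g hg => h2 hg
    -- A vector-valued indicator is a scalar indicator times a fixed vector, which reduces density
    -- to the scalar Fourier system.
    have h3 : ((Lp.simpleFunc.indicatorConst 2 hS hμS.ne c : Lp.simpleFunc X 2 μ) : Lp X 2 μ) =
        Ψ c (indicatorConstLp 2 hS hμS.ne (1 : ℂ)) := by
      rw [Lp.simpleFunc.coe_indicatorConst]
      refine Lp.ext ?_
      filter_upwards [indicatorConstLp_coeFn (p := 2) (hs := hS) (hμs := hμS.ne) (c := c),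
        indicatorConstLp_coeFn (p := 2) (hs := hS) (hμs := hμS.ne) (c := (1 : ℂ)),
        (ContinuousLinearMap.toSpanSingleton ℂ c).coeFn_compLpL (p := 2)
          (indicatorConstLp 2 hS hμS.ne (1 : ℂ))] with t h4 h5 h6
      rw [h4, h6, h5]
      by_cases ht : t ∈ S <;> simp [ht]
    rw [h3]
    exact h1 _
  have hf2 := hf.memLp_two_haarAddCircle
  obtain ⟨q, hq, hqd⟩ := Metric.mem_closure_iff.1 (hs (hf2.toLp f)) ε hε
  obtain ⟨n, c, g, rfl⟩ := Submodule.mem_span_set'.1 hq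
  choose ν y hg using fun i => (g i).2
  refine ⟨n, ν, fun i => c i • y i, ?_⟩
  have hae : (∑ i, c i • (g i : Lp X 2 μ) : Lp X 2 μ) =ᵐ[μ]
      trigPolynomial ν Finset.univ fun i => c i • y i := by
    have h1 : ∀ i, ((c i • (g i : Lp X 2 μ) : Lp X 2 μ) : AddCircle (2 * Real.pi) → X) =ᵐ[μ]
        fun t => fourier (ν i) t • c i • y i := by
      intro i
      filter_upwards [Lp.coeFn_smul (c i) (g i : Lp X 2 μ),
        (ContinuousLinearMap.toSpanSingleton ℂ (y i)).coeFn_compLpL (p := 2)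
          (fourierLp (T := 2 * Real.pi) 2 (ν i)), coeFn_fourierLp (T := 2 * Real.pi) 2 (ν i)]
        with t h2 h3 h4
      rw [h2, Pi.smul_apply, hg i, h3, h4, smul_comm]
      rfl
    filter_upwards [Lp.coeFn_finset_sum Finset.univ (fun i => c i • (g i : Lp X 2 μ)),
      ae_all_iff.2 h1] with t h2 h3
    rw [h2, trigPolynomial]
    exact Finset.sum_congr rfl fun i _ => h3 i
  have htp := (continuous_trigPolynomial ν Finset.univ fun i => c i • y i).memLp_two_haarAddCircle
  have heq : (∑ i, c i • (g i : Lp X 2 μ) : Lp X 2 μ) = htp.toLp _ :=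
    Lp.ext (hae.trans htp.coeFn_toLp.symm)
  rw [heq, dist_comm, dist_eq_norm, ← MemLp.toLp_sub, ← circleNorm_eq_norm_toLp] at hqd
  exact hqd

end Density

section Norming

variable {X : Type*} [NormedAddCommGroup X] [NormedSpace ℂ X]

theorem StrongDual.exists_norm_le_re_apply_ge (φ : StrongDual ℂ X) {ε : ℝ} (hε : 0 < ε) :
    ∃ x : X, ‖x‖ ≤ ‖φ‖ ∧ ‖φ‖ ^ 2 - ε ≤ (φ x).re := by
  rcases eq_or_ne φ 0 with rfl | hφ
  · exact ⟨0, by simp, by simp [hε.le]⟩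
  have hn : 0 < ‖φ‖ := norm_pos_iff.2 hφ
  obtain ⟨x, hx1, hx2⟩ := φ.exists_lt_apply_of_lt_opNorm
    (show ‖φ‖ - ε / ‖φ‖ < ‖φ‖ by linarith [div_pos hε hn])
  -- A unimodular factor makes `φ x` real and nonnegative.
  have hc : ∃ c : ℂ, ‖c‖ = 1 ∧ c * φ x = ‖φ x‖ := by
    rcases eq_or_ne (φ x) 0 with h0 | h0
    · exact ⟨1, by simp, by simp [h0]⟩
    · have h1 : (‖φ x‖ : ℂ) ≠ 0 := Complex.ofReal_ne_zero.2 (norm_ne_zero_iff.2 h0)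
      refine ⟨‖φ x‖ / φ x, ?_, by field_simp⟩
      rw [norm_div, Complex.norm_real, norm_norm, div_self (norm_ne_zero_iff.2 h0)]
  obtain ⟨c, hc1, hc2⟩ := hc
  refine ⟨((‖φ‖ : ℂ) * c) • x, ?_, ?_⟩
  · rw [norm_smul, norm_mul, hc1, Complex.norm_real, norm_norm, mul_one]
    exact mul_le_of_le_one_right hn.le hx1.le
  · rw [map_smul, smul_eq_mul, mul_assoc, hc2, ← Complex.ofReal_mul, Complex.ofReal_re]
    have h2 := mul_le_mul_of_nonneg_left hx2.le hn.le
    rw [mul_sub, mul_div_cancel₀ _ hn.ne'] at h2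
    nlinarith

/-- The admissible vectors at each point form a convex set, and the slack `ε` lets one vector serve
a whole neighbourhood. A partition of unity glues these local constants, so neither measurable
selection nor Bochner duality is needed. -/
theorem exists_continuous_almost_norming {Ω : Type*} [TopologicalSpace Ω] [NormalSpace Ω]
    [ParacompactSpace Ω] {H : Ω → StrongDual ℂ X} (hH : Continuous H) {ε : ℝ} (hε : 0 < ε) :
    ∃ f : C(Ω, X), ∀ t, ‖f t‖ ≤ ‖H t‖ + ε ∧ ‖H t‖ ^ 2 - ε ≤ (H t (f t)).re := by
  refine exists_continuous_forall_mem_convex_of_local_const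
    (t := fun t => {x : X | ‖x‖ ≤ ‖H t‖ + ε ∧ ‖H t‖ ^ 2 - ε ≤ (H t x).re}) (fun t => ?_)
    fun t => ?_
  · refine Convex.inter (s := {x : X | ‖x‖ ≤ ‖H t‖ + ε}) (t := {x | ‖H t‖ ^ 2 - ε ≤ (H t x).re})
      ?_ ?_
    · simpa [Metric.closedBall, dist_zero_right] using convex_closedBall (0 : X) (‖H t‖ + ε)
    · exact convex_halfSpace_ge (f := fun x => (H t x).re)
        ⟨fun x y => by simp, fun c x => by simp⟩ _
  · obtain ⟨x, hx1, hx2⟩ := (H t).exists_norm_le_re_apply_ge (half_pos hε)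
    refine ⟨x, ?_⟩
    have hc' : Continuous fun s => ‖H s‖ + ε := by fun_prop
    have h1 : ∀ᶠ s in 𝓝 t, ‖x‖ < ‖H s‖ + ε :=
      hc'.continuousAt.eventually_const_lt (by linarith)
    have hc : Continuous fun s => (H s x).re - (‖H s‖ ^ 2 - ε) := by fun_prop
    have h2 : ∀ᶠ s in 𝓝 t, 0 < (H s x).re - (‖H s‖ ^ 2 - ε) :=
      hc.continuousAt.eventually_const_lt (by linarith)
    filter_upwards [h1, h2] with s h3 h4
    exact ⟨h3.le, by linarith⟩

theorem Continuous.integrable_haarAddCircle {Y : Type*} [NormedAddCommGroup Y]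
    {f : AddCircle (2 * Real.pi) → Y} (hf : Continuous f) :
    Integrable f AddCircle.haarAddCircle :=
  hf.memLp_two_haarAddCircle.integrable one_le_two

theorem norm_integral_apply_le {H : AddCircle (2 * Real.pi) → StrongDual ℂ X}
    {f : AddCircle (2 * Real.pi) → X} (hH : Continuous H) (hf : Continuous f) :
    ‖∫ t, H t (f t) ∂AddCircle.haarAddCircle‖ ≤ circleNorm H * circleNorm f := by
  refine (norm_integral_le_of_norm_le (g := fun t => ‖H t‖ * ‖f t‖)
    (hH.norm.mul hf.norm).integrable_haarAddCircle
    (Eventually.of_forall fun t => (H t).le_opNorm _)).trans (integral_norm_mul_norm_le hH hf)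

/-- The `L²` norm of a continuous function with values in the dual of `X` is computed by pairing
with `X`-valued trigonometric polynomials. -/
theorem circleNorm_le_of_forall_trigPolynomial {H : AddCircle (2 * Real.pi) → StrongDual ℂ X}
    (hH : Continuous H) {A : ℝ} (hA : 0 ≤ A)
    (h : ∀ (n : ℕ) (ν : Fin n → ℤ) (x : Fin n → X),
      ‖∫ t, H t (trigPolynomial ν Finset.univ x t) ∂AddCircle.haarAddCircle‖ ≤
        A * circleNorm (trigPolynomial ν Finset.univ x)) :
    circleNorm H ≤ A := by
  -- Density extends the hypothesis from trigonometric polynomials to continuous functions.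
  have h1 : ∀ f : AddCircle (2 * Real.pi) → X, Continuous f →
      ‖∫ t, H t (f t) ∂AddCircle.haarAddCircle‖ ≤ A * circleNorm f := by
    intro f hf
    have h2 : ∀ ε > 0, ‖∫ t, H t (f t) ∂AddCircle.haarAddCircle‖ ≤
        A * circleNorm f + ε * (A + circleNorm H) := by
      intro ε hε
      obtain ⟨n, ν, x, hx⟩ := exists_trigPolynomial_circleNorm_sub_lt hf hε
      set q := trigPolynomial ν Finset.univ x with hq
      have hqc : Continuous q := continuous_trigPolynomial _ _ _
      have h3 : ∫ t, H t (f t) ∂AddCircle.haarAddCircle =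
          ∫ t, H t (q t) ∂AddCircle.haarAddCircle -
            ∫ t, H t ((q - f) t) ∂AddCircle.haarAddCircle := by
        rw [← integral_sub (Continuous.integrable_haarAddCircle (by fun_prop))
          (Continuous.integrable_haarAddCircle (by fun_prop))]
        simp
      have h4 := norm_integral_apply_le hH (hqc.sub hf)
      have h5 : circleNorm q ≤ circleNorm (q - f) + circleNorm f := by
        simpa using circleNorm_add_le (hqc.sub hf) hf
      have h6 := h n ν x
      have h7 := norm_sub_le (∫ t, H t (q t) ∂AddCircle.haarAddCircle)
        (∫ t, H t ((q - f) t) ∂AddCircle.haarAddCircle)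
      rw [h3]
      nlinarith [circleNorm_nonneg H, mul_le_mul_of_nonneg_left h5 hA,
        mul_le_mul_of_nonneg_left hx.le hA, mul_le_mul_of_nonneg_left hx.le (circleNorm_nonneg H)]
    refine ge_of_tendsto (x := 𝓝[>] (0 : ℝ)) (f := fun ε => A * circleNorm f +
      ε * (A + circleNorm H)) ?_ (eventually_mem_nhdsWithin.mono h2)
    have hc : Continuous fun ε => A * circleNorm f + ε * (A + circleNorm H) := by fun_prop
    simpa using (hc.tendsto 0).mono_left nhdsWithin_le_nhds
  -- Testing against an almost norming function recovers the square of the norm up to `ε`; letting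
  -- `ε` tend to `0`, one factor then cancels.
  have h2 : ∀ ε > 0, circleNorm H ^ 2 - ε ≤ A * (circleNorm H + ε) := by
    intro ε hε
    obtain ⟨f, hf⟩ := exists_continuous_almost_norming hH hε
    have h3 : circleNorm H ^ 2 - ε ≤ ‖∫ t, H t (f t) ∂AddCircle.haarAddCircle‖ := by
      have hi : Integrable (fun t => H t (f t)) AddCircle.haarAddCircle :=
        Continuous.integrable_haarAddCircle (by fun_prop)
      have h4 : ∫ t, (‖H t‖ ^ 2 - ε) ∂AddCircle.haarAddCircle ≤
          ∫ t, (H t (f t)).re ∂AddCircle.haarAddCircle :=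
        integral_mono (Continuous.integrable_haarAddCircle (by fun_prop)) hi.re fun t => (hf t).2
      rw [integral_sub (Continuous.integrable_haarAddCircle (by fun_prop)) (integrable_const _)]
        at h4
      have h5 : ∫ t, (H t (f t)).re ∂AddCircle.haarAddCircle =
          (∫ t, H t (f t) ∂AddCircle.haarAddCircle).re := integral_re hi
      have h6 : circleNorm H ^ 2 = ∫ t, ‖H t‖ ^ 2 ∂AddCircle.haarAddCircle :=
        Real.sq_sqrt (integral_nonneg fun t => by positivity)
      rw [h5, ← h6] at h4
      simp only [integral_const, probReal_univ, one_smul] at h4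
      exact h4.trans (Complex.re_le_norm _)
    have h4 : circleNorm f ≤ circleNorm H + ε := by
      have h5 : circleNorm f ≤ circleNorm (fun t => ‖H t‖ + ε) := by
        refine Real.sqrt_le_sqrt (integral_mono
          (Continuous.integrable_haarAddCircle (by fun_prop))
          (Continuous.integrable_haarAddCircle (by fun_prop)) fun t => ?_)
        exact pow_le_pow_left₀ (norm_nonneg _) ((hf t).1.trans (le_abs_self _)) 2
      refine h5.trans ((circleNorm_add_le hH.norm continuous_const).trans_eq ?_)
      simp [circleNorm, Real.sqrt_sq hε.le]
    exact h3.trans ((h1 f f.continuous).trans (mul_le_mul_of_nonneg_left h4 hA))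
  have h3 : circleNorm H ^ 2 ≤ A * circleNorm H := by
    have hc : Continuous fun ε => A * (circleNorm H + ε) + ε := by fun_prop
    refine ge_of_tendsto (x := 𝓝[>] (0 : ℝ)) (f := fun ε => A * (circleNorm H + ε) + ε) ?_
      (eventually_mem_nhdsWithin.mono fun ε hε => sub_le_iff_le_add.1 (h2 ε hε))
    simpa using (hc.tendsto 0).mono_left nhdsWithin_le_nhds
  rcases (circleNorm_nonneg H).eq_or_lt with h0 | h0
  · rwa [← h0]
  · rw [sq] at h3
    exact le_of_mul_le_mul_right h3 h0

end Norming

/-! ### Action of the multiplier on lacunary blocks -/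

section Lacunary

theorem closedSpan_le {Y : Type*} [NormedAddCommGroup Y] [NormedSpace ℂ Y]
    {F G V : Submodule ℂ Y} (hV : IsClosed (V : Set Y)) (hF : F ≤ V) (hG : G ≤ V) :
    closedSpan F G ≤ V :=
  Submodule.topologicalClosure_minimal _ (Submodule.span_le.2 (union_subset hF hG)) hV

theorem integral_fourier_eq_zero {n : ℤ} (hn : n ≠ 0) :
    ∫ t : AddCircle (2 * Real.pi), fourier n t ∂AddCircle.haarAddCircle = 0 :=
  integral_eq_zero_of_add_right_eq_neg (fourier_add_half_inv_index hn Real.two_pi_pos)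

/-- The eigenvalue of `P (2n-1)` is half of `2^n`, so the symbol at frequency `s 2^n` is independent
of `n`. Projections are indexed from `0` here, hence `2 * n - 2`. The case `s = 1` serves the space
and `s = -1` its dual. -/
theorem dyadicEigenvalue_div_left {n : ℕ} (hn : 1 ≤ n) (s : ℂ) :
    (dyadicEigenvalue (2 * n - 2) / (dyadicEigenvalue (2 * n - 2) + Complex.I * (s * 2 ^ n)) : ℂ) =
      1 / (1 + 2 * (Complex.I * s)) := by
  obtain ⟨m, rfl⟩ : ∃ m, n = m + 1 := ⟨n - 1, by omega⟩
  have h1 : (2 * (m + 1) - 2 + 1) / 2 = m := by omega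
  simp only [dyadicEigenvalue, h1]
  push_cast
  rw [show (2 ^ m + Complex.I * (s * 2 ^ (m + 1)) : ℂ) = 2 ^ m * (1 + 2 * (Complex.I * s)) by ring,
    ← div_div, div_self (pow_ne_zero _ two_ne_zero)]

theorem dyadicEigenvalue_div_right {n : ℕ} (hn : 1 ≤ n) (s : ℂ) :
    (dyadicEigenvalue (2 * n - 1) / (dyadicEigenvalue (2 * n - 1) + Complex.I * (s * 2 ^ n)) : ℂ) =
      1 / (1 + Complex.I * s) := by
  have h1 : (2 * n - 1 + 1) / 2 = n := by omega
  simp only [dyadicEigenvalue, h1]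
  push_cast
  rw [show (2 ^ n + Complex.I * (s * 2 ^ n) : ℂ) = 2 ^ n * (1 + Complex.I * s) by ring,
    ← div_div, div_self (pow_ne_zero _ two_ne_zero)]

theorem one_div_sub_one_div_ne_zero {s : ℝ} (hs : s ≠ 0) :
    (1 / (1 + Complex.I * s) - 1 / (1 + 2 * (Complex.I * s)) : ℂ) ≠ 0 := by
  have h1 : (1 + Complex.I * s : ℂ) ≠ 0 := fun h => by simpa using congrArg Complex.re h
  have h2 : (1 + 2 * (Complex.I * s) : ℂ) ≠ 0 := fun h => by simpa using congrArg Complex.re h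
  rw [div_sub_div _ _ h1 h2]
  refine div_ne_zero ?_ (mul_ne_zero h1 h2)
  rw [show (1 * (1 + 2 * (Complex.I * s)) - (1 + Complex.I * s) * 1 : ℂ) = Complex.I * s by ring]
  exact mul_ne_zero Complex.I_ne_zero (Complex.ofReal_ne_zero.2 hs)

/-- Used with `γ` the difference of the two block scalars and `g` the output of the multiplier:
subtracting `α` times the input cancels the odd component. -/
theorem circleNorm_trigPolynomial_le_of_smul_eq {ι Y : Type*} [NormedAddCommGroup Y]
    [NormedSpace ℂ Y] {ν : ι → ℤ} {J : Finset ι} {y g u : ι → Y} {γ α : ℂ} {D : ℝ} (hγ : γ ≠ 0)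
    (h : ∀ n ∈ J, γ • y n = g n - α • u n)
    (hg : circleNorm (trigPolynomial ν J g) ≤ D * circleNorm (trigPolynomial ν J u)) :
    circleNorm (trigPolynomial ν J y) ≤ ‖γ‖⁻¹ * (D + ‖α‖) * circleNorm (trigPolynomial ν J u) := by
  have h1 : trigPolynomial ν J y =
      γ⁻¹ • (trigPolynomial ν J g + (-α) • trigPolynomial ν J u) := by
    ext t
    simp only [trigPolynomial, Pi.smul_apply, Pi.add_apply, Finset.smul_sum,
      ← Finset.sum_add_distrib]
    refine Finset.sum_congr rfl fun n hn => ?_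
    rw [← inv_smul_smul₀ hγ (y n), h n hn, smul_sub, smul_add, smul_sub, neg_smul, smul_neg,
      ← sub_eq_add_neg, smul_comm (fourier (ν n) t) γ⁻¹, smul_comm (fourier (ν n) t) γ⁻¹,
      smul_comm (fourier (ν n) t) α]
  rw [h1, circleNorm_const_smul, norm_inv, mul_assoc]
  refine mul_le_mul_of_nonneg_left ?_ (by positivity)
  refine (circleNorm_add_le (continuous_trigPolynomial _ _ _)
    ((continuous_trigPolynomial _ _ _).const_smul _)).trans ?_
  rw [circleNorm_const_smul, norm_neg, add_mul]
  exact add_le_add_left hg _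

variable {X : Type*} [NormedAddCommGroup X] [NormedSpace ℂ X]
  {E : ℕ → Submodule ℂ X} {P : ℕ → X →L[ℂ] X}

/-- The identity holds on both generating subspaces, and the vectors satisfying it form the closed
kernel of a bounded operator. -/
theorem IsSchauderDecomposition.add_eq_of_mem_closedSpan (h : IsSchauderDecomposition E P) {n : ℕ}
    (hn : 1 ≤ n) {x : X} (hx : x ∈ closedSpan (E (2 * n - 1)) (E (2 * n))) :
    P (2 * n - 1) x + P (2 * n) x = x := by
  have key : closedSpan (E (2 * n - 1)) (E (2 * n)) ≤
      (P (2 * n - 1) + P (2 * n) - 1 : X →L[ℂ] X).ker := by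
    refine closedSpan_le (ContinuousLinearMap.isClosed_ker _) (fun y hy => ?_) fun y hy => ?_
    · change P (2 * n - 1) y + P (2 * n) y - y = 0
      rw [h.apply_of_mem (by omega) hy (by omega), h.apply_of_mem (by omega) hy (by omega),
        if_pos rfl, if_neg (by omega)]
      simp
    · change P (2 * n - 1) y + P (2 * n) y - y = 0
      rw [h.apply_of_mem (by omega) hy (by omega), h.apply_of_mem (by omega) hy (by omega),
        if_pos rfl, if_neg (by omega)]
      simp
  exact sub_eq_zero.1 (key hx)

theorem IsSchauderDecomposition.dualAdjoint_add_eq_of_mem_closedSpan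
    (h : IsSchauderDecomposition E P) {n : ℕ} (hn : 1 ≤ n) {φ : StrongDual ℂ X}
    (hφ : φ ∈ closedSpan (dualRange (P (2 * n - 1))) (dualRange (P (2 * n)))) :
    dualAdjoint (P (2 * n - 1)) φ + dualAdjoint (P (2 * n)) φ = φ := by
  have key : closedSpan (dualRange (P (2 * n - 1))) (dualRange (P (2 * n))) ≤
      (dualAdjoint (P (2 * n - 1)) + dualAdjoint (P (2 * n)) - 1 :
        StrongDual ℂ X →L[ℂ] StrongDual ℂ X).ker := by
    refine closedSpan_le (ContinuousLinearMap.isClosed_ker _) ?_ ?_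
    · rintro _ ⟨ψ, rfl⟩
      change dualAdjoint (P (2 * n - 1)) (dualAdjoint (P (2 * n - 1)) ψ) +
        dualAdjoint (P (2 * n)) (dualAdjoint (P (2 * n - 1)) ψ) - dualAdjoint (P (2 * n - 1)) ψ = 0
      ext x
      change ψ (P (2 * n - 1) (P (2 * n - 1) x)) + ψ (P (2 * n - 1) (P (2 * n) x)) -
        ψ (P (2 * n - 1) x) = 0
      rw [h.apply_of_mem (by omega) (h.mem (2 * n) (by omega) x) (by omega),
        h.apply_of_mem (by omega) (h.mem (2 * n - 1) (by omega) x) (by omega),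
        if_pos rfl, if_neg (by omega)]
      simp
    · rintro _ ⟨ψ, rfl⟩
      change dualAdjoint (P (2 * n - 1)) (dualAdjoint (P (2 * n)) ψ) +
        dualAdjoint (P (2 * n)) (dualAdjoint (P (2 * n)) ψ) - dualAdjoint (P (2 * n)) ψ = 0
      ext x
      change ψ (P (2 * n) (P (2 * n - 1) x)) + ψ (P (2 * n) (P (2 * n) x)) -
        ψ (P (2 * n) x) = 0
      rw [h.apply_of_mem (by omega) (h.mem (2 * n) (by omega) x) (by omega),
        h.apply_of_mem (by omega) (h.mem (2 * n - 1) (by omega) x) (by omega),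
        if_pos rfl, if_neg (by omega)]
      simp
  exact sub_eq_zero.1 (key hφ)

theorem IsSchauderDecomposition.sum_smul_apply (h : IsSchauderDecomposition E P) (a : ℕ → ℂ)
    {n N : ℕ} (hn : 1 ≤ n) (hnN : n ≤ N) {x : X} (hx : P (2 * n - 1) x + P (2 * n) x = x) :
    ∑ k ∈ Finset.range (2 * N), a k • P (k + 1) x =
      a (2 * n - 2) • P (2 * n - 1) x + a (2 * n - 1) • P (2 * n) x := by
  have h1 : ∀ l, 1 ≤ l → l ≤ 2 * N → ∑ k ∈ Finset.range (2 * N), a k • P (k + 1) (P l x) =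
      a (l - 1) • P l x := by
    intro l hl hlN
    rw [Finset.sum_eq_single (l - 1)]
    · rw [h.apply_of_mem hl (h.mem l hl x) (by omega), if_pos (by omega)]
    · intro k _ hk
      rw [h.apply_of_mem hl (h.mem l hl x) (by omega), if_neg (by omega), smul_zero]
    · intro hk
      exact absurd (Finset.mem_range.2 (by omega)) hk
  conv_lhs => rw [← hx]
  simp only [map_add, smul_add, Finset.sum_add_distrib]
  rw [h1 _ (by omega) (by omega), h1 _ (by omega) (by omega)]
  rfl

theorem IsSchauderDecomposition.apply_sum_smul (h : IsSchauderDecomposition E P) (a : ℕ → ℂ)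
    {n N : ℕ} (hn : 1 ≤ n) (hnN : n ≤ N) {φ : StrongDual ℂ X}
    (hφ : dualAdjoint (P (2 * n - 1)) φ + dualAdjoint (P (2 * n)) φ = φ) (x : X) :
    φ (∑ k ∈ Finset.range (2 * N), a k • P (k + 1) x) =
      (a (2 * n - 2) • dualAdjoint (P (2 * n - 1)) φ + a (2 * n - 1) • dualAdjoint (P (2 * n)) φ)
        x := by
  have h1 : ∀ l, l + 1 ≤ 2 * N → P (l + 1) (∑ k ∈ Finset.range (2 * N), a k • P (k + 1) x) =
      a l • P (l + 1) x := by
    intro l hl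
    have := h.isCoordinateProjections.apply_sum (fun k => a k • x) l (2 * N)
    simp only [map_smul, if_pos (show l < 2 * N by omega)] at this
    simpa only [map_smul] using this
  have h2 := h1 (2 * n - 2) (by omega)
  have h3 := h1 (2 * n - 1) (by omega)
  rw [show 2 * n - 2 + 1 = 2 * n - 1 by omega] at h2
  rw [show 2 * n - 1 + 1 = 2 * n by omega] at h3
  conv_lhs => rw [← hφ]
  change φ (P (2 * n - 1) _) + φ (P (2 * n) _) =
    a (2 * n - 2) * φ (P (2 * n - 1) x) + a (2 * n - 1) * φ (P (2 * n) x)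
  rw [h2, h3, map_smul, map_smul]
  rfl

theorem IsSchauderDecomposition.dyadicMultiplier_eq (h : IsSchauderDecomposition E P) {N : ℕ}
    {u : ℕ → X} (hu : ∀ n ∈ Finset.Icc 1 N, P (2 * n - 1) (u n) + P (2 * n) (u n) = u n) :
    dyadicMultiplier (fun k => P (k + 1)) (fun n : ℕ => 2 ^ n) (Finset.Icc 1 N) u (2 * N) =
      trigPolynomial (fun n : ℕ => 2 ^ n) (Finset.Icc 1 N) fun n =>
        (1 / (1 + 2 * (Complex.I * (1 : ℝ))) : ℂ) • P (2 * n - 1) (u n) +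
          (1 / (1 + Complex.I * (1 : ℝ)) : ℂ) • P (2 * n) (u n) := by
  ext t
  simp only [dyadicMultiplier, trigPolynomial, map_sum, map_smul]
  rw [Finset.sum_comm]
  refine Finset.sum_congr rfl fun n hn => ?_
  obtain ⟨hn1, hnN⟩ := Finset.mem_Icc.1 hn
  have h1 := h.sum_smul_apply (fun k => (dyadicEigenvalue k /
    (dyadicEigenvalue k + Complex.I * ((1 : ℝ) * 2 ^ n)) : ℂ)) hn1 hnN (hu n hn)
  rw [dyadicEigenvalue_div_left hn1, dyadicEigenvalue_div_right hn1] at h1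
  rw [← h1, Finset.smul_sum]
  refine Finset.sum_congr rfl fun k _ => ?_
  rw [smul_smul, mul_comm]
  congr 2
  push_cast
  rw [one_mul]

/-- By orthogonality of characters only the pairs with `ν j = -2^n` contribute. At these frequencies
the multiplier has the symbol with `s = -1`, which moves onto the functional through the adjoint
projections. -/
theorem IsSchauderDecomposition.integral_trigPolynomial_apply_eq (h : IsSchauderDecomposition E P)
    {N : ℕ} {φ : ℕ → StrongDual ℂ X} (hφ : ∀ n ∈ Finset.Icc 1 N,
      dualAdjoint (P (2 * n - 1)) (φ n) + dualAdjoint (P (2 * n)) (φ n) = φ n)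
    {ι : Type*} (ν : ι → ℤ) (J : Finset ι) (x : ι → X) :
    ∫ t, trigPolynomial (fun n : ℕ => 2 ^ n) (Finset.Icc 1 N) (fun n =>
        (1 / (1 + 2 * (Complex.I * (-1 : ℝ))) : ℂ) • dualAdjoint (P (2 * n - 1)) (φ n) +
          (1 / (1 + Complex.I * (-1 : ℝ)) : ℂ) • dualAdjoint (P (2 * n)) (φ n)) t
        (trigPolynomial ν J x t) ∂AddCircle.haarAddCircle =
      ∫ t, trigPolynomial (fun n : ℕ => 2 ^ n) (Finset.Icc 1 N) φ t
        (dyadicMultiplier (fun k => P (k + 1)) ν J x (2 * N) t) ∂AddCircle.haarAddCircle := by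
  set ψ : ℕ → StrongDual ℂ X := fun n =>
    (1 / (1 + 2 * (Complex.I * (-1 : ℝ))) : ℂ) • dualAdjoint (P (2 * n - 1)) (φ n) +
      (1 / (1 + Complex.I * (-1 : ℝ)) : ℂ) • dualAdjoint (P (2 * n)) (φ n) with hψ
  set y : ι → X := fun j => ∑ k ∈ Finset.range (2 * N),
    (dyadicEigenvalue k / (dyadicEigenvalue k + Complex.I * ν j) : ℂ) • P (k + 1) (x j) with hy
  have hM : dyadicMultiplier (fun k => P (k + 1)) ν J x (2 * N) = trigPolynomial ν J y := by
    ext t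
    simp only [dyadicMultiplier, trigPolynomial, map_sum, map_smul, hy, Finset.smul_sum]
    rw [Finset.sum_comm]
    refine Finset.sum_congr rfl fun j _ => Finset.sum_congr rfl fun k _ => ?_
    rw [smul_smul, mul_comm]
  have hpair : ∀ (χ : ℕ → StrongDual ℂ X) (z : ι → X),
      ∫ t, trigPolynomial (fun n : ℕ => 2 ^ n) (Finset.Icc 1 N) χ t (trigPolynomial ν J z t)
        ∂AddCircle.haarAddCircle =
      ∑ n ∈ Finset.Icc 1 N, ∑ j ∈ J,
        (∫ t : AddCircle (2 * Real.pi), fourier (2 ^ n + ν j) t ∂AddCircle.haarAddCircle) *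
          χ n (z j) := by
    intro χ z
    have h1 : ∀ t, trigPolynomial (fun n : ℕ => 2 ^ n) (Finset.Icc 1 N) χ t
        (trigPolynomial ν J z t) =
        ∑ n ∈ Finset.Icc 1 N, ∑ j ∈ J, fourier (2 ^ n + ν j) t * χ n (z j) := by
      intro t
      simp only [trigPolynomial, sum_apply, smul_apply, map_sum, map_smul, smul_eq_mul,
        Finset.mul_sum, fourier_add]
      rw [Finset.sum_comm]
      refine Finset.sum_congr rfl fun n _ => Finset.sum_congr rfl fun j _ => ?_
      ring
    simp only [h1]
    rw [integral_finsetSum _ fun n _ => Continuous.integrable_haarAddCircle (by fun_prop)]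
    refine Finset.sum_congr rfl fun n _ => ?_
    rw [integral_finsetSum _ fun n _ => Continuous.integrable_haarAddCircle (by fun_prop)]
    refine Finset.sum_congr rfl fun j _ => ?_
    rw [integral_mul_const]
  rw [hM, hpair, hpair]
  refine Finset.sum_congr rfl fun n hn => Finset.sum_congr rfl fun j _ => ?_
  obtain ⟨hn1, hnN⟩ := Finset.mem_Icc.1 hn
  -- The pairing is bilinear, so the surviving frequencies sum to zero; this is where the sign `-1`
  -- comes from.
  by_cases h0 : (2 ^ n + ν j : ℤ) = 0
  · congr 1
    have h1 := h.apply_sum_smul (fun k => (dyadicEigenvalue k /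
      (dyadicEigenvalue k + Complex.I * ((-1 : ℝ) * 2 ^ n)) : ℂ)) hn1 hnN (hφ n hn) (x j)
    rw [dyadicEigenvalue_div_left hn1, dyadicEigenvalue_div_right hn1] at h1
    have h2 : (ν j : ℂ) = (-1 : ℝ) * 2 ^ n := by
      rw [show ν j = -2 ^ n by omega]
      push_cast
      ring
    simp only [hy, h2]
    exact h1.symm
  · rw [integral_fourier_eq_zero h0, zero_mul, zero_mul]

end Lacunary

theorem theorem3p1 {X : Type*} [NormedAddCommGroup X] [NormedSpace ℂ X] [CompleteSpace X]
    (E : ℕ → Submodule ℂ X) (P : ℕ → X →L[ℂ] X) (hEP : IsSchauderDecomposition E P)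
    (T : ℝ) (hT : 0 < T) (hX : HasMRP T X) :
    ∃ C : ℝ, 0 < C ∧
      (∀ (N : ℕ) (u : ℕ → X),
        (∀ n ∈ Finset.Icc 1 N, u n ∈ closedSpan (E (2 * n - 1)) (E (2 * n))) →
        lacunaryNorm N (fun n => P (2 * n) (u n)) ≤ C * lacunaryNorm N u) ∧
      (∀ (N : ℕ) (u : ℕ → StrongDual ℂ X),
        (∀ n ∈ Finset.Icc 1 N,
          u n ∈ closedSpan (dualRange (P (2 * n - 1))) (dualRange (P (2 * n)))) →
        lacunaryNorm N (fun n => dualAdjoint (P (2 * n)) (u n)) ≤ C * lacunaryNorm N u) := by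
  obtain ⟨D, hD0, hD⟩ := hX.exists_circleNorm_dyadicMultiplier_le hEP.isCoordinateProjections hT
  let α : ℝ → ℂ := fun s => 1 / (1 + 2 * (Complex.I * s))
  let β : ℝ → ℂ := fun s => 1 / (1 + Complex.I * s)
  let κ : ℝ → ℝ := fun s => ‖β s - α s‖⁻¹ * (D + ‖α s‖)
  have hκ : ∀ s, 0 ≤ κ s := fun s => by positivity
  have key : ∀ {Y : Type _} [NormedAddCommGroup Y] [NormedSpace ℂ Y] {x y z : Y} (a b : ℂ),
      x + y = z → (b - a) • y = (a • x + b • y) - a • z := by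
    intro Y _ _ x y z a b h
    rw [← h]
    module
  -- `κ 1` serves the first inequality and `κ (-1)` the second; the added `1` ensures strict
  -- positivity.
  refine ⟨κ 1 + κ (-1) + 1, by linarith [hκ 1, hκ (-1)], fun N u hu => ?_, fun N u hu => ?_⟩
  · have hu' : ∀ n ∈ Finset.Icc 1 N, P (2 * n - 1) (u n) + P (2 * n) (u n) = u n := fun n hn =>
      hEP.add_eq_of_mem_closedSpan (Finset.mem_Icc.1 hn).1 (hu n hn)
    have h1 := hD (fun n : ℕ => 2 ^ n) (Finset.Icc 1 N) u (2 * N)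
    rw [hEP.dyadicMultiplier_eq hu'] at h1
    simp only [lacunaryNorm_eq_circleNorm]
    refine (circleNorm_trigPolynomial_le_of_smul_eq (γ := β 1 - α 1) (α := α 1)
      (one_div_sub_one_div_ne_zero one_ne_zero) (fun n hn => ?_) h1).trans
      (mul_le_mul_of_nonneg_right (by linarith [hκ (-1)]) (circleNorm_nonneg _))
    exact key _ _ (hu' n hn)
  · have hu' : ∀ n ∈ Finset.Icc 1 N,
        dualAdjoint (P (2 * n - 1)) (u n) + dualAdjoint (P (2 * n)) (u n) = u n := fun n hn =>
      hEP.dualAdjoint_add_eq_of_mem_closedSpan (Finset.mem_Icc.1 hn).1 (hu n hn)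
    simp only [lacunaryNorm_eq_circleNorm]
    -- The adjoint multiplier is bounded by testing; each test is moved back to `X`, where `hD`
    -- applies to arbitrary frequencies.
    have h1 := circleNorm_le_of_forall_trigPolynomial
      (continuous_trigPolynomial (fun n : ℕ => 2 ^ n) (Finset.Icc 1 N) (fun n =>
        α (-1) • dualAdjoint (P (2 * n - 1)) (u n) + β (-1) • dualAdjoint (P (2 * n)) (u n)))
      (A := D * circleNorm (trigPolynomial (fun n : ℕ => 2 ^ n) (Finset.Icc 1 N) u))
      (mul_nonneg hD0 (circleNorm_nonneg _)) fun n ν x => ?_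
    · refine (circleNorm_trigPolynomial_le_of_smul_eq (γ := β (-1) - α (-1)) (α := α (-1))
        (one_div_sub_one_div_ne_zero (by norm_num)) (fun n hn => ?_) h1).trans
        (mul_le_mul_of_nonneg_right (by linarith [hκ 1]) (circleNorm_nonneg _))
      exact key _ _ (hu' n hn)
    · rw [hEP.integral_trigPolynomial_apply_eq hu']
      refine (norm_integral_apply_le (continuous_trigPolynomial _ _ _)
        (continuous_dyadicMultiplier _ _ _ _)).trans ?_
      rw [mul_right_comm, mul_comm]
      exact mul_le_mul_of_nonneg_right (hD ν Finset.univ x (2 * N)) (circleNorm_nonneg _)
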